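/- Let $P$ be a right LCM semigroup, i.e. a left cancellative semigroup with identity such that for all $p,q\in P$ either $pP\cap qP=\emptyset$ or $pP\cap qP=rP$ for some $r\in P$; write $p\geq q$ if $p\in qP$. Let $\mathcal L$ be a right-tensor $C^*$-precategory over $P$: a $C^*$-precategory with object set $P$ and Banach spaces of morphisms $\mathcal L(p,q)$ (from $q$ to $p$), together with linear maps $\mathcal L(p,q)\to\mathcal L(pr,qr)$, $a\mapsto a\otimes 1_r$, $r\in P$, that are compatible with composition and involution and satisfy $a\otimes 1_e=a$ and $(a\otimes 1_r)\otimes 1_s=a\otimes 1_{rs}$. Let $\mathcal K$ be an ideal in $\mathcal L$ (closed subspaces $\mathcal K(p,q)\subseteq\mathcal L(p,q)$, stable under composition with morphisms of $\mathcal L$ on both sides) that is well-aligned: whenever $pP\cap qP=rP$, $(a\otimes 1_{p^{-1}r})(b\otimes 1_{q^{-1}r})\in\mathcal K(r,r)$ for all $a\in\mathcal K(p,p)$, $b\in\mathcal K(q,q)$. Here $p^{-1}r$ denotes the unique $v\in P$ with $pv=r$. A representation $\Phi$ of $\mathcal K$ in a $C^*$-algebra $B$ is a family of linear maps $\Phi_{p,q}:\mathcal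 K(p,q)\to B$ (all written $\Phi$) with $\Phi(a^*)=\Phi(a)^*$ and $\Phi(ab)=\Phi(a)\Phi(b)$ for composable $a,b$; it is injective if every $\Phi_{p,p}$ is injective. It is Nica covariant if for all $a\in\mathcal K(p,q)$, $b\in\mathcal K(s,t)$, $$\Phi(a)\Phi(b)=\begin{cases}\Phi\big((a\otimes 1_{q^{-1}r})(b\otimes 1_{s^{-1}r})\big)&\text{if } qP\cap sP=rP \text{ for some } r\in P,\\ 0&\text{otherwise.}\end{cases}$$ A Nica covariant $\Phi$ is Toeplitz covariant if $\Phi(\mathcal K(p,p))\cap\overline{\operatorname{span}}\{\Phi(\mathcal K(q_i,q_i)):i=1,\dots,n\}=\{0\}$ for all $p,q_1,\dots,q_n\in P$ with $p\not\geq q_i$ for every $i$. Let $\mathcal{NT}_{\mathcal L}(\mathcal K)$, with universal representation $i_{\mathcal K}$, be the universal $C^*$-algebra for Nica covariant representations of $\mathcal K$; for a Nica covariant $\Phi:\mathcal K\to B$ let $\Phi\rtimes P:\mathcal{NT}_{\mathcal L}(\mathcal K)\to B$ be the $*$-homomorphism with $(\Phi\rtimes P)\circ i_{\mathcal K}=\Phi$,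 and let $B_e^{\Phi}=\overline{\operatorname{span}}\bigcup_{p\in P}\Phi(\mathcal K(p,p))$ be its core, a $C^*$-subalgebra of $B$. Let $\mathcal F_{\mathcal K}=\bigoplus_{s,t\in P}\mathcal K(s,t)$, a right Hilbert module over $\bigoplus_{t\in P}\mathcal K(t,t)$ with $\langle x,y\rangle=x^*y\in\mathcal K(t,t)$ for $x,y\in\mathcal K(s,t)$. The Fock representation $T$ of $\mathcal K$ in the adjointable operators on $\mathcal F_{\mathcal K}$ is given, for $a\in\mathcal K(p,q)$ and $x\in\mathcal K(s,t)$, by $T(a)x=(a\otimes 1_{q^{-1}s})x$ if $s\in qP$, and $T(a)x=0$ otherwise. Then: 1. $T$ is an injective, Nica covariant and Toeplitz covariant representation of $\mathcal K$; equivalently (by 2), $T\rtimes P$ restricts to an isomorphism $B_e^{i_{\mathcal K}}\to B_e^{T}$, and this holds. 2. For every Nica covariant representation $\Phi:\mathcal K\to B$ of $\mathcal K$ in a $C^*$-algebra, $\Phi\rtimes P$ restricts to an isomorphism $B_e^{i_{\mathcal K}}\to B_e^{\Phi}$ if and only if $\Phi$ is injective and Toeplitz covariant. Likewise, $\Phi\rtimes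 P$ is injective on $B_e^{i_{\mathcal K}}$ if and only if $\Phi$ is injective and Toeplitz covariant. -/

import Mathlib

open scoped ENNReal

universe u v w

theorem NonUnitalCStarAlgebra.exists_approx {A : Type*} [NonUnitalCStarAlgebra A] (b : A)
    {ε : ℝ} (hε : 0 < ε) :
    ∃ k : A, star k = k ∧
      (∀ s : NonUnitalStarSubalgebra ℂ A, IsClosed (s : Set A) → star b * b ∈ s → k ∈ s) ∧
      ‖star b * b - star b * b * k - (k * (star b * b) - k * (star b * b) * k)‖ ≤ ε := by
  let _ := CStarAlgebra.spectralOrder A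
  have _ := CStarAlgebra.spectralOrderedRing A
  set h := star b * b with hh
  have h0 : 0 ≤ h := star_mul_self_nonneg b
  have hsa : IsSelfAdjoint h := .of_nonneg h0
  have hq : ∀ x ∈ quasispectrum ℝ h, 0 ≤ x := fun x hx => quasispectrum_nonneg_of_nonneg h h0 x hx
  have hc : ContinuousOn (fun x : ℝ => x / (x + ε)) (quasispectrum ℝ h) :=
    ContinuousOn.div (by fun_prop) (by fun_prop) fun x hx => by have := hq x hx; positivity
  refine ⟨cfcₙ (fun x : ℝ => x / (x + ε)) h, ?_, ?_, ?_⟩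
  · exact (cfcₙ_predicate (R := ℝ) _ h : IsSelfAdjoint _)
  · intro s hs hm
    have : IsClosed (s : Set A) := hs
    exact cfcₙ_mem (𝕜' := ℂ) _ hm
  · have e2 : ∀ f : ℝ → ℝ, f 0 = 0 → ContinuousOn f (quasispectrum ℝ h) →
        h - h * cfcₙ f h - (cfcₙ f h * h - cfcₙ f h * h * cfcₙ f h) =
          cfcₙ (fun x : ℝ => x - x * f x - (f x * x - f x * x * f x)) h := by
      intro f f0 hf
      have ci : ContinuousOn (fun x : ℝ => x) (quasispectrum ℝ h) := continuousOn_id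
      have c1 : ContinuousOn (fun x : ℝ => x * f x) (quasispectrum ℝ h) := ci.mul hf
      have c2 : ContinuousOn (fun x : ℝ => f x * x) (quasispectrum ℝ h) := hf.mul ci
      have c3 : ContinuousOn (fun x : ℝ => f x * x * f x) (quasispectrum ℝ h) := c2.mul hf
      have m1 : cfcₙ (fun x : ℝ => x * f x) h = h * cfcₙ f h := by
        rw [cfcₙ_mul (fun x : ℝ => x) f h ci rfl hf f0, cfcₙ_id' ℝ h]
      have m2 : cfcₙ (fun x : ℝ => f x * x) h = cfcₙ f h * h := by
        rw [cfcₙ_mul f (fun x : ℝ => x) h hf f0 ci rfl, cfcₙ_id' ℝ h]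
      have m3 : cfcₙ (fun x : ℝ => f x * x * f x) h = cfcₙ f h * h * cfcₙ f h := by
        rw [cfcₙ_mul (fun x : ℝ => f x * x) f h c2 (by simp) hf f0, m2]
      rw [cfcₙ_sub (fun x : ℝ => x - x * f x) (fun x : ℝ => f x * x - f x * x * f x) h
          (ci.sub c1) (by simp) (c2.sub c3) (by simp),
        cfcₙ_sub (fun x : ℝ => x) (fun x : ℝ => x * f x) h ci rfl c1 (by simp),
        cfcₙ_sub (fun x : ℝ => f x * x) (fun x : ℝ => f x * x * f x) h c2 (by simp) c3 (by simp),
        m1, m2, m3, cfcₙ_id' ℝ h]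
    rw [e2 (fun x : ℝ => x / (x + ε)) (zero_div _) hc]
    refine norm_cfcₙ_le fun x hx => ?_
    have hx0 := hq x hx
    have hp : 0 < x + ε := by positivity
    have : x - x * (x / (x + ε)) - (x / (x + ε) * x - x / (x + ε) * x * (x / (x + ε)))
      = x * ε ^ 2 / (x + ε) ^ 2 := by field_simp; ring
    rw [this, Real.norm_of_nonneg (by positivity), div_le_iff₀ (by positivity)]
    nlinarith [mul_nonneg hx0 hx0, mul_nonneg hx0 hε.le, mul_pos hε hε,
      mul_nonneg (mul_nonneg hx0 hx0) hε.le, mul_pos (mul_pos hε hε) hε, mul_nonneg hx0 (mul_pos hε hε).le]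

theorem NonUnitalCStarAlgebra.exists_sqrt {A : Type*} [NonUnitalCStarAlgebra A] (b : A) :
    ∃ k : A, star k = k ∧
      (∀ s : NonUnitalStarSubalgebra ℂ A, IsClosed (s : Set A) → star b * b ∈ s → k ∈ s) ∧
      k * k = star b * b := by
  let _ := CStarAlgebra.spectralOrder A
  have _ := CStarAlgebra.spectralOrderedRing A
  set h := star b * b with hh
  have h0 : 0 ≤ h := star_mul_self_nonneg b
  have hsa : IsSelfAdjoint h := .of_nonneg h0
  have hq : ∀ x ∈ quasispectrum ℝ h, 0 ≤ x := fun x hx => quasispectrum_nonneg_of_nonneg h h0 x hx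
  refine ⟨cfcₙ Real.sqrt h, ?_, ?_, ?_⟩
  · exact (cfcₙ_predicate (R := ℝ) _ h : IsSelfAdjoint _)
  · intro s hs hm
    have : IsClosed (s : Set A) := hs
    exact cfcₙ_mem (𝕜' := ℂ) _ hm
  · rw [← cfcₙ_mul _ _ h]
    conv_rhs => rw [← cfcₙ_id' ℝ h]
    exact cfcₙ_congr fun x hx => Real.mul_self_sqrt (hq x hx)

/-- A `C^*`-precategory with object set `O`; `Hom σ ρ` is the space of morphisms from `ρ` to
`σ`, `comp a b` is the composition `a b`, and `adj a` is `a^*`. -/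
structure CStarPrecategory (O : Type u) where
  Hom : O → O → Type v
  [normedAddCommGroup : ∀ σ ρ, NormedAddCommGroup (Hom σ ρ)]
  [normedSpace : ∀ σ ρ, NormedSpace ℂ (Hom σ ρ)]
  [completeSpace : ∀ σ ρ, CompleteSpace (Hom σ ρ)]
  comp : ∀ {τ σ ρ : O}, Hom τ σ →ₗ[ℂ] Hom σ ρ →ₗ[ℂ] Hom τ ρ
  comp_assoc : ∀ {π τ σ ρ : O} (a : Hom π τ) (b : Hom τ σ) (c : Hom σ ρ),
    comp (comp a b) c = comp a (comp b c)
  norm_comp_le : ∀ {τ σ ρ : O} (a : Hom τ σ) (b : Hom σ ρ), ‖comp a b‖ ≤ ‖a‖ * ‖b‖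
  adj : ∀ {σ ρ : O}, Hom σ ρ →ₗ⋆[ℂ] Hom ρ σ
  adj_adj : ∀ {σ ρ : O} (a : Hom σ ρ), adj (adj a) = a
  adj_comp : ∀ {τ σ ρ : O} (a : Hom τ σ) (b : Hom σ ρ),
    adj (comp a b) = comp (adj b) (adj a)
  norm_adj_comp_self : ∀ {σ ρ : O} (a : Hom σ ρ), ‖comp (adj a) a‖ = ‖a‖ ^ 2
  exists_adj_comp_self : ∀ {σ ρ : O} (a : Hom σ ρ), ∃ b : Hom ρ ρ,
    comp (adj a) a = comp (adj b) b

namespace CStarPrecategory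

attribute [instance] normedAddCommGroup normedSpace completeSpace

variable {O : Type u} (L : CStarPrecategory.{u, v} O)

/-- The endomorphisms of an object form a `C^*`-algebra. -/
noncomputable instance (ρ : O) : NonUnitalCStarAlgebra (L.Hom ρ ρ) :=
  { L.normedAddCommGroup ρ ρ, L.normedSpace ρ ρ, L.completeSpace ρ ρ with
    mul := fun a b => L.comp a b
    star := fun a => L.adj a
    left_distrib := fun a b c => by
      change L.comp a (b + c) = _
      rw [map_add]; rfl
    right_distrib := fun a b c => by
      change L.comp (a + b) c = _
      rw [map_add]; rfl
    zero_mul := fun a => by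
      change L.comp 0 a = 0
      simp
    mul_zero := fun a => by
      change L.comp a 0 = 0
      simp
    mul_assoc := fun a b c => L.comp_assoc a b c
    norm_mul_le := fun a b => L.norm_comp_le a b
    star_involutive := fun a => L.adj_adj a
    star_mul := fun a b => L.adj_comp a b
    star_add := fun a b => map_add L.adj a b
    star_smul := fun c a => L.adj.map_smulₛₗ c a
    norm_mul_self_le := fun a => by
      change ‖a‖ * ‖a‖ ≤ ‖L.comp (L.adj a) a‖
      rw [L.norm_adj_comp_self, sq]
    smul_assoc := fun c a b => by
      change L.comp (c • a) b = c • L.comp a b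
      simp
    smul_comm := fun c a b => by
      change c • L.comp a b = L.comp a (c • b)
      simp }

theorem mul_def {ρ : O} (a b : L.Hom ρ ρ) : a * b = L.comp a b := rfl

theorem star_def {ρ : O} (a : L.Hom ρ ρ) : star a = L.adj a := rfl


theorem norm_adj {σ ρ : O} (a : L.Hom σ ρ) : ‖L.adj a‖ = ‖a‖ := by
  have key : ∀ {σ ρ : O} (a : L.Hom σ ρ), ‖a‖ ≤ ‖L.adj a‖ := fun a => by
    rcases eq_or_ne ‖a‖ 0 with h | h
    · rw [h]; positivity
    · have h1 := L.norm_adj_comp_self a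
      have h2 := L.norm_comp_le (L.adj a) a
      have h3 : 0 < ‖a‖ := lt_of_le_of_ne (norm_nonneg _) (Ne.symm h)
      nlinarith
  refine le_antisymm ?_ (key a)
  simpa [L.adj_adj] using key (L.adj a)

/-- Transport of morphisms along equalities of objects. -/
def castHom {σ σ' ρ ρ' : O} (h : σ = σ') (h' : ρ = ρ') (a : L.Hom σ ρ) : L.Hom σ' ρ' :=
  cast (congrArg₂ L.Hom h h') a

/-- An ideal in a `C^*`-precategory. -/
structure Ideal where
  carrier : ∀ σ ρ : O, Submodule ℂ (L.Hom σ ρ)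
  isClosed : ∀ σ ρ : O, IsClosed (carrier σ ρ : Set (L.Hom σ ρ))
  comp_mem_left : ∀ {τ σ ρ : O} (a : L.Hom τ σ) {b : L.Hom σ ρ},
    b ∈ carrier σ ρ → L.comp a b ∈ carrier τ ρ
  comp_mem_right : ∀ {τ σ ρ : O} {a : L.Hom τ σ} (b : L.Hom σ ρ),
    a ∈ carrier τ σ → L.comp a b ∈ carrier τ ρ

namespace Ideal

variable {L} (K : L.Ideal)

/-- The `*`-algebra of all `a` with `a, a^* ∈ K(ρ,ρ)`; by `adj_mem` below this is all of
`K(ρ,ρ)`. -/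
def diag (ρ : O) : NonUnitalStarSubalgebra ℂ (L.Hom ρ ρ) where
  carrier := {a | a ∈ K.carrier ρ ρ ∧ L.adj a ∈ K.carrier ρ ρ}
  add_mem' := fun {a b} ha hb => ⟨add_mem ha.1 hb.1, by rw [map_add]; exact add_mem ha.2 hb.2⟩
  zero_mem' := ⟨zero_mem _, by rw [map_zero]; exact zero_mem _⟩
  mul_mem' := fun {a b} ha hb => ⟨K.comp_mem_left a hb.1, by
    rw [L.mul_def, L.adj_comp]; exact K.comp_mem_left _ ha.2⟩
  smul_mem' := fun c a ha => ⟨Submodule.smul_mem _ c ha.1, by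
    rw [LinearMap.map_smulₛₗ]; exact Submodule.smul_mem _ _ ha.2⟩
  star_mem' := fun {a} ha => ⟨ha.2, by rw [L.star_def, L.adj_adj]; exact ha.1⟩

theorem isClosed_diag (ρ : O) : IsClosed (K.diag ρ : Set (L.Hom ρ ρ)) :=
  (K.isClosed ρ ρ).inter ((K.isClosed ρ ρ).preimage (continuous_star (R := L.Hom ρ ρ)))

theorem adj_comp_self_mem_diag {σ ρ : O} {a : L.Hom σ ρ} (ha : a ∈ K.carrier σ ρ) :
    L.comp (L.adj a) a ∈ K.diag ρ :=
  ⟨K.comp_mem_left _ ha, by rw [L.adj_comp, L.adj_adj]; exact K.comp_mem_left _ ha⟩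

theorem exists_approx {σ ρ : O} {a : L.Hom σ ρ} (ha : a ∈ K.carrier σ ρ) {ε : ℝ} (hε : 0 < ε) :
    ∃ k ∈ K.carrier ρ ρ, L.adj k = k ∧ ‖a - L.comp a k‖ ≤ ε := by
  obtain ⟨b, hb⟩ := L.exists_adj_comp_self a
  obtain ⟨k, hk, hm, hn⟩ := NonUnitalCStarAlgebra.exists_approx b (pow_pos hε 2)
  refine ⟨k, (hm (K.diag ρ) (K.isClosed_diag ρ) ?_).1, hk, ?_⟩
  · rw [L.star_def, L.mul_def, ← hb]
    exact K.adj_comp_self_mem_diag ha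
  · refine (abs_le_of_sq_le_sq' ?_ hε.le).2
    rw [← L.norm_adj_comp_self]
    refine le_of_eq_of_le ?_ hn
    congr 1
    simp only [L.star_def, L.mul_def] at hk ⊢
    simp only [← hb, map_sub, LinearMap.sub_apply, L.adj_comp, hk, L.comp_assoc]
    abel

theorem adj_mem {σ ρ : O} {a : L.Hom σ ρ} (ha : a ∈ K.carrier σ ρ) :
    L.adj a ∈ K.carrier ρ σ := by
  refine (K.isClosed ρ σ).closure_subset ?_
  refine Metric.mem_closure_iff.2 fun ε hε => ?_
  obtain ⟨k, hk, hk', hn⟩ := K.exists_approx ha (half_pos hε)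
  refine ⟨L.comp k (L.adj a), K.comp_mem_right _ hk, ?_⟩
  rw [dist_eq_norm]
  calc ‖L.adj a - L.comp k (L.adj a)‖ = ‖L.adj (a - L.comp a k)‖ := by
        rw [map_sub, L.adj_comp, hk']
    _ ≤ ε / 2 := by rw [L.norm_adj]; exact hn
    _ < ε := by linarith

/-- An ideal in a `C^*`-precategory is a `C^*`-precategory. -/
noncomputable def toPrecategory : CStarPrecategory.{u, v} O where
  Hom σ ρ := K.carrier σ ρ
  completeSpace σ ρ := (K.isClosed σ ρ).completeSpace_coe
  comp := LinearMap.mk₂ ℂ (fun a b => ⟨L.comp a.1 b.1, K.comp_mem_left _ b.2⟩)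
    (fun _ _ _ => Subtype.ext (by simp)) (fun _ _ _ => Subtype.ext (by simp))
    (fun _ _ _ => Subtype.ext (by simp)) (fun _ _ _ => Subtype.ext (by simp))
  comp_assoc a b c := Subtype.ext (L.comp_assoc a.1 b.1 c.1)
  norm_comp_le a b := L.norm_comp_le a.1 b.1
  adj :=
    { toFun := fun a => ⟨L.adj a.1, K.adj_mem a.2⟩
      map_add' := fun _ _ => Subtype.ext (by simp)
      map_smul' := fun _ _ => Subtype.ext (by simp) }
  adj_adj a := Subtype.ext (L.adj_adj a.1)
  adj_comp a b := Subtype.ext (L.adj_comp a.1 b.1)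
  norm_adj_comp_self a := L.norm_adj_comp_self a.1
  exists_adj_comp_self {σ ρ} a := by
    obtain ⟨b, hb⟩ := L.exists_adj_comp_self a.1
    obtain ⟨k, hk, hm, hn⟩ := NonUnitalCStarAlgebra.exists_sqrt b
    refine ⟨⟨k, (hm (K.diag ρ) (K.isClosed_diag ρ) ?_).1⟩, Subtype.ext ?_⟩
    · rw [L.star_def, L.mul_def, ← hb]
      exact K.adj_comp_self_mem_diag a.2
    · change L.comp (L.adj a.1) a.1 = L.comp (L.adj k) k
      rw [← L.star_def, hk, hb]
      exact hn.symm

end Ideal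

end CStarPrecategory

/-- The principal right ideal `pP` of a semigroup `P`. -/
def rightIdeal {P : Type u} [Monoid P] (p : P) : Set P := Set.range (fun r => p * r)

/-- A right LCM semigroup (with identity). -/
class RightLCMSemigroup (P : Type u) [Monoid P] : Prop extends IsLeftCancelMul P where
  inter_rightIdeal : ∀ p q : P, rightIdeal p ∩ rightIdeal q = ∅ ∨
    ∃ r, rightIdeal p ∩ rightIdeal q = rightIdeal r

/-- A right-tensor `C^*`-precategory over `P`; `tens r a` is `a ⊗ 1_r`. -/
structure RightTensorPrecategory (P : Type u) [Monoid P] extends CStarPrecategory.{u, v} P where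
  tens : ∀ (r : P) {p q : P}, Hom p q →ₗ[ℂ] Hom (p * r) (q * r)
  tens_comp : ∀ (r : P) {p q s : P} (a : Hom p q) (b : Hom q s),
    tens r (comp a b) = comp (tens r a) (tens r b)
  tens_adj : ∀ (r : P) {p q : P} (a : Hom p q), tens r (adj a) = adj (tens r a)
  tens_one : ∀ {p q : P} (a : Hom p q), HEq (tens 1 a) a
  tens_tens : ∀ (r s : P) {p q : P} (a : Hom p q), HEq (tens s (tens r a)) (tens (r * s) a)

namespace CStarPrecategory

variable {O : Type u} {L : CStarPrecategory.{u, v} O}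

@[simp] theorem castHom_rfl {σ ρ : O} (a : L.Hom σ ρ) : L.castHom rfl rfl a = a := rfl

theorem castHom_heq {σ σ' ρ ρ' : O} (h : σ = σ') (h' : ρ = ρ') (a : L.Hom σ ρ) :
    HEq (L.castHom h h' a) a := by subst h; subst h'; rfl

theorem castHom_comp {τ τ' σ σ' ρ ρ' : O} (h : τ = τ') (h' : σ = σ') (h'' : ρ = ρ')
    (a : L.Hom τ σ) (b : L.Hom σ ρ) :
    L.castHom h h'' (L.comp a b) = L.comp (L.castHom h h' a) (L.castHom h' h'' b) := by
  subst h; subst h'; subst h''; rfl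

end CStarPrecategory

namespace RightTensorPrecategory

variable {P : Type u} [Monoid P] (L : RightTensorPrecategory.{u, v} P)

theorem norm_tens_le (r : P) {p q : P} (a : L.Hom p q) : ‖L.tens r a‖ ≤ ‖a‖ := by
  let φ : L.Hom q q →⋆ₙₐ[ℂ] L.Hom (q * r) (q * r) :=
    { toFun := L.tens r
      map_smul' := fun c x => map_smul _ c x
      map_zero' := map_zero _
      map_add' := map_add _
      map_mul' := fun x y => L.tens_comp r x y
      map_star' := fun x => L.tens_adj r x }
  refine (abs_le_of_sq_le_sq' ?_ (norm_nonneg a)).2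
  have h := NonUnitalStarAlgHom.norm_apply_le φ (L.comp (L.adj a) a)
  rw [← L.norm_adj_comp_self, ← L.norm_adj_comp_self, ← L.tens_adj, ← L.tens_comp]
  exact h

/-- An ideal is well-aligned if `(a ⊗ 1_{p⁻¹r}) (b ⊗ 1_{q⁻¹r}) ∈ K(r,r)` for all `a ∈ K(p,p)`,
`b ∈ K(q,q)` whenever `pP ∩ qP = rP`. Here `v = p⁻¹r` and `w = q⁻¹r`. -/
def IsWellAligned (K : L.Ideal) : Prop :=
  ∀ (p q r v w : P) (hv : p * v = r) (hw : q * w = r),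
    rightIdeal p ∩ rightIdeal q = rightIdeal r →
    ∀ a ∈ K.carrier p p, ∀ b ∈ K.carrier q q,
      L.comp (L.castHom hv hv (L.tens v a)) (L.castHom hw hw (L.tens w b)) ∈ K.carrier r r

variable {L} {K : L.Ideal}

theorem IsWellAligned.mem (hK : L.IsWellAligned K) {p q s t r v w : P} (hv : q * v = r)
    (hw : s * w = r) (hr : rightIdeal q ∩ rightIdeal s = rightIdeal r)
    {a : L.Hom p q} (ha : a ∈ K.carrier p q) {b : L.Hom s t} (hb : b ∈ K.carrier s t) :
    L.comp (L.castHom rfl hv (L.tens v a)) (L.castHom hw rfl (L.tens w b)) ∈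
      K.carrier (p * v) (t * w) := by
  subst hv
  simp only [CStarPrecategory.castHom_rfl]
  have tc : ∀ (r : P) {p q : P}, Continuous (L.tens r : L.Hom p q → L.Hom (p * r) (q * r)) :=
    fun r p q => AddMonoidHomClass.continuous_of_bound (L.tens r) 1
      fun x => by simpa using L.norm_tens_le r x
  have cl : ∀ {p q s : P} (a : L.Hom p q), Continuous fun b : L.Hom q s => L.comp a b :=
    fun a => AddMonoidHomClass.continuous_of_bound (L.comp a) ‖a‖ fun x => L.norm_comp_le a x
  have cr : ∀ {p q s : P} (b : L.Hom q s), Continuous fun a : L.Hom p q => L.comp a b :=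
    fun {p q s} b => AddMonoidHomClass.continuous_of_bound
      ((L.comp (τ := p)).flip b) ‖b‖ fun x => by
        rw [mul_comm]; exact L.norm_comp_le x b
  have cc : ∀ {p q p' q' : P} (h : p = p') (h' : q = q'),
      Continuous (L.castHom h h' : L.Hom p q → L.Hom p' q') := by
    intro p q p' q' h h'; subst h; subst h'; exact continuous_id
  -- first reduce to `a = a k`
  have h1 : a ∈ closure {x | ∃ k ∈ K.carrier q q, x = L.comp a k} :=
    Metric.mem_closure_iff.2 fun ε hε => by
      obtain ⟨k, hk, -, hn⟩ := K.exists_approx ha (half_pos hε)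
      exact ⟨_, ⟨k, hk, rfl⟩, by rw [dist_eq_norm]; linarith⟩
  have h2 : b ∈ closure {x | ∃ k ∈ K.carrier s s, x = L.comp k b} :=
    Metric.mem_closure_iff.2 fun ε hε => by
      obtain ⟨k, hk, hk', hn⟩ := K.exists_approx (K.adj_mem hb) (half_pos hε)
      refine ⟨_, ⟨k, hk, rfl⟩, ?_⟩
      rw [dist_eq_norm, ← L.norm_adj, map_sub, L.adj_comp, hk']
      linarith
  have h3 : ∀ k ∈ K.carrier q q, ∀ k' ∈ K.carrier s s,
      L.comp (L.tens v (L.comp a k)) (L.castHom hw rfl (L.tens w (L.comp k' b))) ∈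
        K.carrier (p * v) (t * w) := by
    intro k hk k' hk'
    have h := hK q s (q * v) v w rfl hw hr k hk k' hk'
    have e : L.castHom hw rfl (L.tens w (L.comp k' b)) =
        L.comp (L.castHom hw hw (L.tens w k')) (L.castHom hw rfl (L.tens w b)) := by
      rw [L.tens_comp, CStarPrecategory.castHom_comp hw hw rfl]
    rw [e, L.tens_comp, L.comp_assoc, ← L.comp_assoc (L.tens v k)]
    exact K.comp_mem_left _ (K.comp_mem_right _ h)
  have h4 : ∀ k' ∈ K.carrier s s,
      L.comp (L.tens v a) (L.castHom hw rfl (L.tens w (L.comp k' b))) ∈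
        K.carrier (p * v) (t * w) := by
    intro k' hk'
    let f := fun x : L.Hom p q =>
      L.comp (L.tens v x) (L.castHom hw rfl (L.tens w (L.comp k' b)))
    have hc : Continuous f := (cr _).comp (tc v)
    refine (K.isClosed _ _).closure_subset ?_
    refine map_mem_closure (f := f) hc h1 ?_
    rintro x ⟨k, hk, rfl⟩
    exact h3 k hk k' hk'
  let f := fun y : L.Hom s t => L.comp (L.tens v a) (L.castHom hw rfl (L.tens w y))
  have hc : Continuous f :=
    (cl _).comp ((cc hw rfl).comp (tc w))
  refine (K.isClosed _ _).closure_subset ?_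
  refine map_mem_closure (f := f) hc h2 ?_
  rintro y ⟨k', hk', rfl⟩
  exact h4 k' hk'

/-- For `a ∈ K(p,q)`, `b ∈ K(s,t)` and `qP ∩ sP = rP`, this is the element
`(a ⊗ 1_{q⁻¹r}) (b ⊗ 1_{s⁻¹r})` of `K(pq⁻¹r, ts⁻¹r)`, where `v = q⁻¹r` and `w = s⁻¹r`. -/
def IsWellAligned.prod (hK : L.IsWellAligned K) {p q s t r v w : P} (hv : q * v = r)
    (hw : s * w = r) (hr : rightIdeal q ∩ rightIdeal s = rightIdeal r)
    (a : K.carrier p q) (b : K.carrier s t) : K.carrier (p * v) (t * w) :=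
  ⟨L.comp (L.castHom rfl hv (L.tens v a)) (L.castHom hw rfl (L.tens w b)),
    hK.mem hv hw hr a.2 b.2⟩

end RightTensorPrecategory

/-- A representation of a `C^*`-precategory in a `C^*`-algebra. -/
structure CStarPrecategory.Representation {O : Type u} (C : CStarPrecategory.{u, v} O)
    (B : Type w) [NonUnitalCStarAlgebra B] where
  toFun : ∀ σ ρ : O, C.Hom σ ρ →ₗ[ℂ] B
  map_adj : ∀ {σ ρ : O} (a : C.Hom σ ρ), toFun ρ σ (C.adj a) = star (toFun σ ρ a)
  map_comp : ∀ {τ σ ρ : O} (a : C.Hom τ σ) (b : C.Hom σ ρ),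
    toFun τ ρ (C.comp a b) = toFun τ σ a * toFun σ ρ b

namespace CStarPrecategory.Representation

variable {O : Type u} {C : CStarPrecategory.{u, v} O} {B : Type w} [NonUnitalCStarAlgebra B]
  (Φ : C.Representation B)

/-- A representation is injective if it is injective on the diagonal spaces. -/
def IsInjective : Prop := ∀ ρ : O, Function.Injective (Φ.toFun ρ ρ)

theorem norm_map_le {σ ρ : O} (a : C.Hom σ ρ) : ‖Φ.toFun σ ρ a‖ ≤ ‖a‖ := by
  let φ : C.Hom ρ ρ →⋆ₙₐ[ℂ] B :=
    { toFun := Φ.toFun ρ ρ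
      map_smul' := fun c x => map_smul _ c x
      map_zero' := map_zero _
      map_add' := map_add _
      map_mul' := fun x y => Φ.map_comp x y
      map_star' := fun x => Φ.map_adj x }
  refine (abs_le_of_sq_le_sq' ?_ (norm_nonneg a)).2
  have h := NonUnitalStarAlgHom.norm_apply_le φ (C.comp (C.adj a) a)
  rw [← C.norm_adj_comp_self, sq, ← CStarRing.norm_star_mul_self, ← Φ.map_adj, ← Φ.map_comp]
  exact h

/-- The `C^*`-algebra `C^*(Φ(C))` generated by a representation. -/
def generated : NonUnitalStarSubalgebra ℂ B :=
  (NonUnitalStarAlgebra.adjoin ℂ (⋃ (σ : O) (ρ : O), Set.range (Φ.toFun σ ρ))).topologicalClosure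

end CStarPrecategory.Representation

namespace RightTensorPrecategory

variable {P : Type u} [Monoid P] {L : RightTensorPrecategory.{u, v} P} {K : L.Ideal}
  {B : Type w} [NonUnitalCStarAlgebra B]

/-- Nica covariance of a representation of a well-aligned ideal. -/
def IsNicaCovariant (hK : L.IsWellAligned K) (Φ : K.toPrecategory.Representation B) : Prop :=
  ∀ (p q s t : P) (a : K.carrier p q) (b : K.carrier s t),
    (∀ (r v w : P) (hv : q * v = r) (hw : s * w = r)
      (hr : rightIdeal q ∩ rightIdeal s = rightIdeal r),
      Φ.toFun p q a * Φ.toFun s t b = Φ.toFun (p * v) (t * w) (hK.prod hv hw hr a b)) ∧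
    ((∀ r, rightIdeal q ∩ rightIdeal s ≠ rightIdeal r) → Φ.toFun p q a * Φ.toFun s t b = 0)

/-- Toeplitz covariance; `p ≱ q` means `p ∉ qP`. -/
def IsToeplitzCovariant (Φ : K.toPrecategory.Representation B) : Prop :=
  ∀ (p : P) (F : Finset P), (∀ q ∈ F, p ∉ rightIdeal q) →
    (LinearMap.range (Φ.toFun p p) : Set B) ∩
      closure (Submodule.span ℂ (⋃ q ∈ F, Set.range (Φ.toFun q q)) : Set B) = {0}

end RightTensorPrecategory

namespace CStarModule

section DirectSum

variable (A : Type*) [NonUnitalCStarAlgebra A] [PartialOrder A] [StarOrderedRing A]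
  {ι : Type*} (E : ι → Type*) [∀ i, NormedAddCommGroup (E i)] [∀ i, NormedSpace ℂ (E i)]
  [∀ i, SMul A (E i)] [∀ i, CStarModule A (E i)]

theorem norm_sum_inner_le (F : Finset ι) (x y : ∀ i, E i) :
    ‖∑ i ∈ F, inner A (x i) (y i)‖ ≤
      √‖∑ i ∈ F, inner A (x i) (x i)‖ * √‖∑ i ∈ F, inner A (y i) (y i)‖ := by
  have h := CStarModule.norm_inner_le (A := A) (WithCStarModule A (∀ i : F, E i))
    (x := (WithCStarModule.equiv A _).symm fun i => x i)
    (y := (WithCStarModule.equiv A _).symm fun i => y i)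
  simp only [WithCStarModule.pi_norm, WithCStarModule.pi_inner,
    WithCStarModule.equiv_symm_pi_apply] at h
  rwa [Finset.sum_coe_sort F fun i => inner A (x i) (y i),
    Finset.sum_coe_sort F fun i => inner A (x i) (x i),
    Finset.sum_coe_sort F fun i => inner A (y i) (y i)] at h

theorem sqrt_norm_sum_inner_add_le (F : Finset ι) (x y : ∀ i, E i) :
    √‖∑ i ∈ F, inner A (x i + y i) (x i + y i)‖ ≤
      √‖∑ i ∈ F, inner A (x i) (x i)‖ + √‖∑ i ∈ F, inner A (y i) (y i)‖ := by
  have h1 := norm_sum_inner_le A E F x y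
  have h2 := norm_sum_inner_le A E F y x
  have e : ∑ i ∈ F, inner A (x i + y i) (x i + y i) = ∑ i ∈ F, inner A (x i) (x i) +
      ∑ i ∈ F, inner A (y i) (x i) + ∑ i ∈ F, inner A (x i) (y i)
      + ∑ i ∈ F, inner A (y i) (y i) := by
    simp only [inner_add_left, inner_add_right, Finset.sum_add_distrib]
    abel
  rw [Real.sqrt_le_left (by positivity), e]
  have n1 := norm_add_le (∑ i ∈ F, inner A (x i) (x i) +
      ∑ i ∈ F, inner A (y i) (x i) + ∑ i ∈ F, inner A (x i) (y i))
      (∑ i ∈ F, inner A (y i) (y i))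
  have n2 := norm_add₃_le (a := ∑ i ∈ F, inner A (x i) (x i))
    (b := ∑ i ∈ F, inner A (y i) (x i)) (c := ∑ i ∈ F, inner A (x i) (y i))
  have s1 := Real.sq_sqrt (norm_nonneg (∑ i ∈ F, inner A (x i) (x i)))
  have s2 := Real.sq_sqrt (norm_nonneg (∑ i ∈ F, inner A (y i) (y i)))
  nlinarith

/-- The vectors of the direct sum of Hilbert `C^*`-modules: families `x` for which
`∑ ⟨x i, x i⟩` converges in `A`. -/
def directSumSubmodule : Submodule ℂ (∀ i, E i) where
  carrier := {x | Summable fun i => inner A (x i) (x i)}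
  zero_mem' := by
    change Summable fun i => inner A (0 : E i) (0 : E i)
    simp
  smul_mem' c x hx := by
    change Summable fun i => inner A (c • x i) (c • x i)
    simp only [inner_smul_left_complex, inner_smul_right_complex]
    exact (hx.const_smul (star c)).const_smul c
  add_mem' {x y} hx hy := by
    change Summable fun i => inner A (x i + y i) (x i + y i)
    have hx' := summable_iff_vanishing_norm.1 hx
    have hy' := summable_iff_vanishing_norm.1 hy
    refine summable_iff_vanishing_norm.2 fun ε hε => ?_
    classical
    obtain ⟨s, hs⟩ := hx' (ε / 4) (by positivity)
    obtain ⟨s', hs'⟩ := hy' (ε / 4) (by positivity)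
    refine ⟨s ∪ s', fun t ht => ?_⟩
    rw [Finset.disjoint_union_right] at ht
    have h1 := hs t ht.1
    have h2 := hs' t ht.2
    have h3 := sqrt_norm_sum_inner_add_le A E t x y
    have s1 := Real.sq_sqrt (norm_nonneg (∑ i ∈ t, inner A (x i) (x i)))
    have s2 := Real.sq_sqrt (norm_nonneg (∑ i ∈ t, inner A (y i) (y i)))
    have s3 := Real.sq_sqrt (norm_nonneg (∑ i ∈ t, inner A (x i + y i) (x i + y i)))
    have p3 := Real.sqrt_nonneg ‖∑ i ∈ t, inner A (x i + y i) (x i + y i)‖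
    nlinarith [sq_nonneg (√‖∑ i ∈ t, inner A (x i) (x i)‖ - √‖∑ i ∈ t, inner A (y i) (y i)‖)]

/-- The (exterior) direct sum of a family of Hilbert `C^*`-modules. -/
def DirectSum : Type _ := directSumSubmodule A E

namespace DirectSum

noncomputable instance : AddCommGroup (DirectSum A E) :=
  inferInstanceAs (AddCommGroup (directSumSubmodule A E))

noncomputable instance : Module ℂ (DirectSum A E) :=
  inferInstanceAs (Module ℂ (directSumSubmodule A E))

variable {A E}

theorem ext {x y : DirectSum A E} (h : ∀ i, x.1 i = y.1 i) : x = y := Subtype.ext (funext h)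

@[simp] theorem add_apply (x y : DirectSum A E) (i : ι) : (x + y).1 i = x.1 i + y.1 i := rfl
@[simp] theorem sub_apply (x y : DirectSum A E) (i : ι) : (x - y).1 i = x.1 i - y.1 i := rfl
@[simp] theorem zero_apply (i : ι) : (0 : DirectSum A E).1 i = 0 := rfl
@[simp] theorem smul_apply (c : ℂ) (x : DirectSum A E) (i : ι) : (c • x).1 i = c • x.1 i := rfl

theorem summable_self (x : DirectSum A E) : Summable fun i => inner A (x.1 i) (x.1 i) := x.2

theorem summable_inner (x y : DirectSum A E) : Summable fun i => inner A (x.1 i) (y.1 i) := by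
  have hx' := summable_iff_vanishing_norm.1 x.summable_self
  have hy' := summable_iff_vanishing_norm.1 y.summable_self
  refine summable_iff_vanishing_norm.2 fun ε hε => ?_
  classical
  obtain ⟨s, hs⟩ := hx' ε hε
  obtain ⟨s', hs'⟩ := hy' ε hε
  refine ⟨s ∪ s', fun t ht => ?_⟩
  rw [Finset.disjoint_union_right] at ht
  have h1 := hs t ht.1
  have h2 := hs' t ht.2
  have h3 := norm_sum_inner_le A E t x.1 y.1
  have s1 := Real.sq_sqrt (norm_nonneg (∑ i ∈ t, inner A (x.1 i) (x.1 i)))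
  have s2 := Real.sq_sqrt (norm_nonneg (∑ i ∈ t, inner A (y.1 i) (y.1 i)))
  nlinarith [sq_nonneg (√‖∑ i ∈ t, inner A (x.1 i) (x.1 i)‖ -
    √‖∑ i ∈ t, inner A (y.1 i) (y.1 i)‖)]

noncomputable instance : SMul A (DirectSum A E) where
  smul a x := ⟨fun i => a • x.1 i, by
    change Summable fun i => inner A (a • x.1 i) (a • x.1 i)
    simp only [inner_op_smul_left, inner_op_smul_right]
    simpa only [mul_assoc] using (x.summable_self.mul_left a).mul_right (star a)⟩

noncomputable instance : Inner A (DirectSum A E) where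
  inner x y := ∑' i, inner A (x.1 i) (y.1 i)

theorem inner_def (x y : DirectSum A E) : inner A x y = ∑' i, inner A (x.1 i) (y.1 i) := rfl

noncomputable instance : Norm (DirectSum A E) := CStarModule.norm A

noncomputable instance : CStarModule A (DirectSum A E) where
  inner_add_right {x y z} := by
    simp only [inner_def, add_apply, inner_add_right]
    exact (x.summable_inner y).tsum_add (x.summable_inner z)
  inner_self_nonneg {x} := tsum_nonneg fun i => inner_self_nonneg
  inner_self {x} := by
    refine ⟨fun h => ext fun i => ?_, fun h => ?_⟩
    · refine (inner_self (A := A)).1 (le_antisymm ?_ inner_self_nonneg)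
      exact (x.summable_self.le_tsum i fun _ _ => inner_self_nonneg).trans_eq h
    · subst h
      simp [inner_def]
  inner_op_smul_right {a x y} := by
    simp only [inner_def]
    rw [← (x.summable_inner y).tsum_mul_left a]
    exact tsum_congr fun i => inner_op_smul_right
  inner_smul_right_complex {z x y} := by
    simp only [inner_def, smul_apply, inner_smul_right_complex]
    exact (x.summable_inner y).tsum_const_smul z
  star_inner x y := by
    simp only [inner_def]
    rw [tsum_star]
    exact tsum_congr fun i => star_inner _ _
  norm_eq_sqrt_norm_inner_self x := rfl

noncomputable instance : NormedAddCommGroup (DirectSum A E) :=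
  NormedAddCommGroup.ofCore (CStarModule.normedSpaceCore A)

noncomputable instance : NormedSpace ℂ (DirectSum A E) :=
  NormedSpace.ofCore (CStarModule.normedSpaceCore A)

theorem norm_def (x : DirectSum A E) : ‖x‖ = √‖∑' i, inner A (x.1 i) (x.1 i)‖ := rfl

theorem sqrt_norm_sum_le (F : Finset ι) (x : DirectSum A E) :
    √‖∑ i ∈ F, inner A (x.1 i) (x.1 i)‖ ≤ ‖x‖ :=
  Real.sqrt_le_sqrt <| CStarAlgebra.norm_le_norm_of_nonneg_of_le
    (Finset.sum_nonneg fun _ _ => inner_self_nonneg)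
    (x.summable_self.sum_le_tsum F fun _ _ => inner_self_nonneg)

theorem norm_le_of_forall {x : DirectSum A E} {C : ℝ}
    (h : ∀ F : Finset ι, √‖∑ i ∈ F, inner A (x.1 i) (x.1 i)‖ ≤ C) : ‖x‖ ≤ C :=
  le_of_tendsto ((Real.continuous_sqrt.comp continuous_norm).continuousAt.tendsto.comp
    x.summable_self.hasSum) (Filter.Eventually.of_forall h)

theorem norm_apply_le (x : DirectSum A E) (i : ι) : ‖x.1 i‖ ≤ ‖x‖ := by
  simpa [norm_eq_sqrt_norm_inner_self (A := A) (x.1 i)] using sqrt_norm_sum_le {i} x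

instance [∀ i, CompleteSpace (E i)] : CompleteSpace (DirectSum A E) := by
  refine Metric.complete_of_cauchySeq_tendsto fun u hu => ?_
  have hc : ∀ i, CauchySeq fun n => (u n).1 i := fun i => by
    refine Metric.cauchySeq_iff.2 fun ε hε => ?_
    obtain ⟨N, hN⟩ := Metric.cauchySeq_iff.1 hu ε hε
    refine ⟨N, fun m hm n hn => lt_of_le_of_lt ?_ (hN m hm n hn)⟩
    rw [dist_eq_norm, dist_eq_norm]
    exact norm_apply_le (u m - u n) i
  choose l hl using fun i => cauchySeq_tendsto_of_complete (hc i)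
  have key : ∀ ε > 0, ∃ N, ∀ n ≥ N, ∀ F : Finset ι,
      √‖∑ i ∈ F, inner A (l i - (u n).1 i) (l i - (u n).1 i)‖ ≤ ε := by
    intro ε hε
    obtain ⟨N, hN⟩ := Metric.cauchySeq_iff.1 hu ε hε
    refine ⟨N, fun n hn F => ?_⟩
    have ht : Filter.Tendsto (fun m => √‖∑ i ∈ F, inner A ((u m).1 i - (u n).1 i)
        ((u m).1 i - (u n).1 i)‖) Filter.atTop
        (nhds √‖∑ i ∈ F, inner A (l i - (u n).1 i) (l i - (u n).1 i)‖) := by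
      refine (Real.continuous_sqrt.comp continuous_norm).continuousAt.tendsto.comp ?_
      refine tendsto_finsetSum _ fun i _ => ?_
      have h := (hl i).sub_const ((u n).1 i)
      exact (continuous_inner (A := A) (E := E i)).continuousAt.tendsto.comp (h.prodMk_nhds h)
    refine le_of_tendsto ht (Filter.eventually_atTop.2 ⟨N, fun m hm => ?_⟩)
    refine (sqrt_norm_sum_le F (u m - u n)).trans ?_
    rw [← dist_eq_norm]
    exact (hN m hm n hn).le
  have hmem : Summable fun i => inner A (l i) (l i) := by
    refine summable_iff_vanishing_norm.2 fun ε hε => ?_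
    have hs : 0 < √ε := Real.sqrt_pos.2 hε
    obtain ⟨N, hN⟩ := key (√ε / 2) (by positivity)
    obtain ⟨s, hs'⟩ := summable_iff_vanishing_norm.1 (u N).summable_self (ε / 4) (by positivity)
    refine ⟨s, fun t ht => ?_⟩
    have h1 := hN N le_rfl t
    have h2 := hs' t ht
    have h3 := sqrt_norm_sum_inner_add_le A E t (fun i => l i - (u N).1 i) (u N).1
    simp only [sub_add_cancel] at h3
    have h4 : √‖∑ i ∈ t, inner A ((u N).1 i) ((u N).1 i)‖ < √ε / 2 := by
      rw [Real.sqrt_lt' (by positivity), div_pow, Real.sq_sqrt hε.le]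
      linarith
    rw [← Real.sqrt_lt_sqrt_iff (norm_nonneg _)]
    linarith
  let x : DirectSum A E := ⟨l, hmem⟩
  refine ⟨x, Metric.tendsto_atTop.2 fun ε hε => ?_⟩
  obtain ⟨N, hN⟩ := key (ε / 2) (by positivity)
  refine ⟨N, fun n hn => ?_⟩
  rw [dist_comm, dist_eq_norm]
  have : ‖x - u n‖ ≤ ε / 2 := norm_le_of_forall fun F => hN n hn F
  linarith

end DirectSum

end DirectSum

section Adjointable

variable (A : Type*) [NonUnitalCStarAlgebra A] [PartialOrder A] [StarOrderedRing A]
  (E : Type*) [NormedAddCommGroup E] [NormedSpace ℂ E] [SMul A E] [CStarModule A E]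

/-- The algebra `𝓛(E)` of adjointable operators on a Hilbert `C^*`-module. -/
def adjointable : Subalgebra ℂ (E →L[ℂ] E) where
  carrier := {S | ∃ S' : E →L[ℂ] E, ∀ x y, inner A (S x) y = inner A x (S' y)}
  mul_mem' := by
    rintro S R ⟨S', hS⟩ ⟨R', hR⟩
    exact ⟨R' * S', fun x y => by simp [hS, hR]⟩
  add_mem' := by
    rintro S R ⟨S', hS⟩ ⟨R', hR⟩
    exact ⟨S' + R', fun x y => by simp [hS, hR]⟩
  algebraMap_mem' c := ⟨algebraMap ℂ _ (star c), fun x y => by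
    simp [Algebra.algebraMap_eq_smul_one]⟩

variable {A E}

theorem ext_inner {x y : E} (h : ∀ z : E, inner A z x = inner A z y) : x = y := by
  rw [← sub_eq_zero, ← inner_self (A := A), inner_sub_right, h, sub_self]

theorem norm_le_of_adjoint {S S' : E →L[ℂ] E}
    (h : ∀ x y, inner A (S x) y = inner A x (S' y)) : ‖S‖ ≤ ‖S'‖ := by
  refine S.opNorm_le_bound (norm_nonneg _) fun x => ?_
  have h1 : ‖S x‖ ^ 2 ≤ ‖x‖ * (‖S'‖ * ‖S x‖) := by
    rw [norm_sq_eq A, h]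
    exact (norm_inner_le E).trans (by gcongr; exact S'.le_opNorm _)
  rcases (norm_nonneg (S x)).eq_or_lt with h0 | h0
  · rw [← h0]; positivity
  · nlinarith

theorem norm_sq_le_of_adjoint {S S' : E →L[ℂ] E}
    (h : ∀ x y, inner A (S x) y = inner A x (S' y)) : ‖S‖ * ‖S‖ ≤ ‖S' * S‖ := by
  have : ‖S‖ ≤ √‖S' * S‖ := by
    refine S.opNorm_le_bound (Real.sqrt_nonneg _) fun x => ?_
    refine (abs_le_of_sq_le_sq' ?_ (by positivity)).2
    rw [norm_sq_eq A, h, mul_pow, Real.sq_sqrt (norm_nonneg _)]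
    calc _ ≤ ‖x‖ * ‖(S' * S) x‖ := norm_inner_le E
      _ ≤ ‖x‖ * (‖S' * S‖ * ‖x‖) := by gcongr; exact (S' * S).le_opNorm _
      _ = _ := by ring
  calc ‖S‖ * ‖S‖ ≤ √‖S' * S‖ * √‖S' * S‖ := by gcongr
    _ = _ := Real.mul_self_sqrt (norm_nonneg _)

noncomputable instance : Star (adjointable A E) where
  star S := ⟨S.2.choose, S.1, fun x y => by
    rw [← star_inner, ← S.2.choose_spec, star_inner]⟩

theorem inner_apply_left (S : adjointable A E) (x y : E) :
    inner A (S.1 x) y = inner A x ((star S).1 y) := S.2.choose_spec x y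

theorem star_eq_of_adjoint {S R : adjointable A E}
    (h : ∀ x y, inner A (S.1 x) y = inner A x (R.1 y)) : star S = R :=
  Subtype.ext <| ContinuousLinearMap.ext fun y => ext_inner (A := A) fun z => by
    rw [← inner_apply_left, h]

theorem isClosed_adjointable [CompleteSpace E] :
    IsClosed (adjointable A E : Set (E →L[ℂ] E)) := by
  refine isSeqClosed_iff_isClosed.1 fun S R hS hR => ?_
  choose S' hS' using hS
  have hS'' : ∀ n x y, inner A (S' n x) y = inner A x (S n y) := fun n x y => by
    rw [← star_inner, ← hS', star_inner]
  have hc : CauchySeq S' := by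
    refine Metric.cauchySeq_iff.2 fun ε hε => ?_
    obtain ⟨N, hN⟩ := Metric.cauchySeq_iff.1 hR.cauchySeq ε hε
    refine ⟨N, fun m hm n hn => lt_of_le_of_lt ?_ (hN m hm n hn)⟩
    rw [dist_eq_norm, dist_eq_norm]
    refine norm_le_of_adjoint (A := A) fun x y => ?_
    simp only [sub_apply, inner_sub_left, inner_sub_right, hS'']
  obtain ⟨R', hR'⟩ := cauchySeq_tendsto_of_complete hc
  refine ⟨R', fun x y => ?_⟩
  have ev : ∀ x : E, Continuous fun T : E →L[ℂ] E => T x := fun x => by fun_prop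
  have h1 : Filter.Tendsto (fun n => inner A (S n x) y) Filter.atTop (nhds (inner A (R x) y)) :=
    (continuous_inner (A := A)).continuousAt.tendsto.comp
      ((((ev x).tendsto R).comp hR).prodMk_nhds tendsto_const_nhds)
  have h2 : Filter.Tendsto (fun n => inner A x (S' n y)) Filter.atTop
      (nhds (inner A x (R' y))) :=
    (continuous_inner (A := A)).continuousAt.tendsto.comp
      (tendsto_const_nhds.prodMk_nhds (((ev y).tendsto R').comp hR'))
  simp only [hS'] at h1
  exact tendsto_nhds_unique h1 h2

noncomputable instance [CompleteSpace E] : CStarAlgebra (adjointable A E) where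
  star_involutive S := star_eq_of_adjoint fun x y => by
    rw [← star_inner, ← inner_apply_left, star_inner]
  star_mul S R := star_eq_of_adjoint fun x y => by
    simp [inner_apply_left]
  star_add S R := star_eq_of_adjoint fun x y => by
    simp [inner_apply_left]
  star_smul c S := star_eq_of_adjoint fun x y => by
    simp [inner_apply_left]
  norm_mul_self_le S := norm_sq_le_of_adjoint (A := A) (inner_apply_left S)
  complete := (isClosed_adjointable (A := A) (E := E)).completeSpace_coe.complete

end Adjointable

end CStarModule

namespace CStarPrecategory

variable {O : Type u} (C : CStarPrecategory.{u, v} O)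

/-- The `C^*`-algebraic direct sum `⨁_t C(t,t)`: bounded families vanishing at infinity. -/
def diagSum : NonUnitalStarSubalgebra ℂ (lp (fun t => C.Hom t t) ∞) where
  carrier := {f | Filter.Tendsto (fun t => ‖f t‖) Filter.cofinite (nhds 0)}
  zero_mem' := by simpa using tendsto_const_nhds
  add_mem' {f g} hf hg := squeeze_zero (fun _ => norm_nonneg _) (fun _ => norm_add_le _ _)
    (by simpa using hf.add hg)
  smul_mem' c f hf := by
    change Filter.Tendsto (fun t => ‖c • f t‖) Filter.cofinite (nhds 0)
    simpa [norm_smul] using hf.const_mul ‖c‖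
  mul_mem' {f g} hf hg := squeeze_zero (fun _ => norm_nonneg _) (fun _ => norm_mul_le _ _)
    (by simpa using hf.mul hg)
  star_mem' {f} hf := by
    change Filter.Tendsto (fun t => ‖star (f t)‖) Filter.cofinite (nhds 0)
    simpa using hf

theorem isClosed_diagSum : IsClosed (C.diagSum : Set (lp (fun t => C.Hom t t) ∞)) := by
  refine isClosed_of_closure_subset fun f hf => ?_
  change Filter.Tendsto (fun t => ‖f t‖) Filter.cofinite (nhds 0)
  refine Metric.tendsto_nhds.2 fun ε hε => ?_
  obtain ⟨g, hg, hfg⟩ := Metric.mem_closure_iff.1 hf (ε / 2) (by positivity)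
  have hg' : Filter.Tendsto (fun t => ‖g t‖) Filter.cofinite (nhds 0) := hg
  filter_upwards [Metric.tendsto_nhds.1 hg' (ε / 2) (by positivity)] with t ht
  rw [dist_eq_norm] at hfg
  simp only [Real.dist_eq, sub_zero, abs_norm] at ht ⊢
  have h1 : ‖f t - g t‖ ≤ ‖f - g‖ := lp.norm_apply_le_norm ENNReal.top_ne_zero (f - g) t
  have h2 : ‖f t‖ ≤ ‖f t - g t‖ + ‖g t‖ := by simpa using norm_add_le (f t - g t) (g t)
  linarith

noncomputable instance : NonUnitalCStarAlgebra C.diagSum :=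
  NonUnitalStarSubalgebra.nonUnitalCStarAlgebra C.diagSum (h_closed := C.isClosed_diagSum)

noncomputable instance : PartialOrder (C.diagSum)ᵐᵒᵖ := CStarAlgebra.spectralOrder _

instance : StarOrderedRing (C.diagSum)ᵐᵒᵖ := CStarAlgebra.spectralOrderedRing _

open Classical in
/-- The embedding of a summand `C(t,t)` in `⨁_t C(t,t)`. -/
noncomputable def single (t : O) : C.Hom t t →ₗ[ℂ] C.diagSum where
  toFun a := ⟨lp.single ∞ t a, by
    refine tendsto_const_nhds.congr' ?_
    refine Filter.mem_cofinite.2 ((Set.finite_singleton t).subset fun s hs => ?_)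
    by_contra hst
    exact hs (by
      change 0 = ‖lp.single (E := fun t => C.Hom t t) ∞ t a s‖
      rw [lp.single_apply_ne _ _ _ hst, norm_zero])⟩
  map_add' a b := Subtype.ext (lp.single_add _ _ _ _)
  map_smul' c a := Subtype.ext (lp.single_smul _ _ _ _)

theorem norm_single (t : O) (a : C.Hom t t) : ‖C.single t a‖ = ‖a‖ := by
  classical exact lp.norm_single (E := fun t => C.Hom t t) ENNReal.zero_lt_top t a

theorem single_mul (t : O) (a : C.Hom t t) (f : C.diagSum) :
    C.single t a * f = C.single t (a * f.1 t) := by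
  classical
  refine Subtype.ext (lp.ext (funext fun s => ?_))
  change lp.single (E := fun t => C.Hom t t) ∞ t a s * f.1 s =
    lp.single (E := fun t => C.Hom t t) ∞ t (a * f.1 t) s
  rcases eq_or_ne s t with rfl | h
  · simp only [lp.single_apply_self]
  · rw [lp.single_apply_ne _ _ _ h, lp.single_apply_ne _ _ _ h, zero_mul]

theorem single_apply (t : O) (a : C.Hom t t) : (C.single t a).1 t = a := by
  classical exact lp.single_apply_self (E := fun t => C.Hom t t) ∞ t a

theorem star_single (t : O) (a : C.Hom t t) : star (C.single t a) = C.single t (C.adj a) := by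
  classical
  refine Subtype.ext (lp.ext (funext fun s => ?_))
  change star (lp.single (E := fun t => C.Hom t t) ∞ t a s) =
    lp.single (E := fun t => C.Hom t t) ∞ t (C.adj a) s
  rcases eq_or_ne s t with rfl | h
  · simp only [lp.single_apply_self]; rfl
  · rw [lp.single_apply_ne _ _ _ h, lp.single_apply_ne _ _ _ h, star_zero]

theorem op_single_adj_comp_self_nonneg {s t : O} (x : C.Hom s t) :
    0 ≤ MulOpposite.op (C.single t (C.comp (C.adj x) x)) := by
  obtain ⟨b, hb⟩ := C.exists_adj_comp_self x
  have e : MulOpposite.op (C.single t (C.comp (C.adj x) x)) =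
      MulOpposite.op (C.single t b) * star (MulOpposite.op (C.single t b)) := by
    rw [← MulOpposite.op_star, ← MulOpposite.op_mul, star_single, single_mul, single_apply, hb]
    rfl
  rw [e]
  exact mul_star_self_nonneg _

noncomputable instance : NonUnitalCStarAlgebra (C.diagSum)ᵐᵒᵖ := inferInstance

noncomputable instance : NonUnitalRing (C.diagSum)ᵐᵒᵖ := inferInstance

noncomputable instance : NonUnitalNormedRing (C.diagSum)ᵐᵒᵖ := inferInstance

noncomputable instance : NormedAddCommGroup (C.diagSum)ᵐᵒᵖ := inferInstance

noncomputable instance : AddCommGroup (C.diagSum)ᵐᵒᵖ := inferInstance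

noncomputable instance : NormedSpace ℂ (C.diagSum)ᵐᵒᵖ := inferInstance

noncomputable instance : StarRing (C.diagSum)ᵐᵒᵖ := inferInstance

/-- `C(s,t)` is a right module over `⨁_t C(t,t)`, the summands other than `C(t,t)` acting as
zero; right modules are modules over the opposite algebra. -/
noncomputable instance (s t : O) : SMul (C.diagSum)ᵐᵒᵖ (C.Hom s t) where
  smul f x := C.comp x (f.unop.1 t)

/-- `C(s,t)` is a right Hilbert module over `⨁_t C(t,t)`, with inner product `⟨x, y⟩ = x^* y`
in the summand `C(t,t)`. Right Hilbert modules over an algebra are Hilbert modules in the sense of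
`CStarModule` (which are left-handed) over the opposite algebra. -/
noncomputable instance (s t : O) : CStarModule (C.diagSum)ᵐᵒᵖ (C.Hom s t) where
  inner x y := MulOpposite.op (C.single t (C.comp (C.adj x) y))
  inner_add_right {x y z} := by simp
  inner_self_nonneg {x} := C.op_single_adj_comp_self_nonneg x
  inner_self {x} := by
    rw [← norm_eq_zero, MulOpposite.norm_op, norm_single, C.norm_adj_comp_self]
    simp
  inner_op_smul_right {f x y} := by
    change MulOpposite.op (C.single t (C.comp (C.adj x) (C.comp y (f.unop.1 t)))) = _
    rw [← C.comp_assoc, ← C.mul_def, ← single_mul, MulOpposite.op_mul, MulOpposite.op_unop]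
  inner_smul_right_complex {z x y} := by simp
  star_inner x y := by
    rw [← MulOpposite.op_star, star_single, C.adj_comp, C.adj_adj]
  norm_eq_sqrt_norm_inner_self x := by
    rw [MulOpposite.norm_op, norm_single, C.norm_adj_comp_self, Real.sqrt_sq (norm_nonneg x)]

theorem inner_hom {s t : O} (x y : C.Hom s t) :
    inner (C.diagSum)ᵐᵒᵖ x y = MulOpposite.op (C.single t (C.comp (C.adj x) y)) := rfl

/-- The Fock module `⨁_{s,t} C(s,t)`, as a Hilbert module over `⨁_t C(t,t)`. -/
abbrev FockModule : Type (max u v) :=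
  CStarModule.DirectSum (C.diagSum)ᵐᵒᵖ fun i : O × O => C.Hom i.1 i.2

/-- The `C^*`-algebra of adjointable operators on the Fock module. -/
abbrev FockAlgebra : Type (max u v) :=
  CStarModule.adjointable (C.diagSum)ᵐᵒᵖ C.FockModule

end CStarPrecategory

theorem CStarModule.DirectSum.summable_of_le {A : Type*} [NonUnitalCStarAlgebra A] [PartialOrder A]
    [StarOrderedRing A] {ι : Type*} {f g : ι → A} (hf : ∀ i, 0 ≤ f i) (hfg : ∀ i, f i ≤ g i)
    (hg : Summable g) : Summable f := by
  refine summable_iff_vanishing_norm.2 fun ε hε => ?_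
  obtain ⟨s, hs⟩ := summable_iff_vanishing_norm.1 hg ε hε
  refine ⟨s, fun t ht => lt_of_le_of_lt ?_ (hs t ht)⟩
  exact CStarAlgebra.norm_le_norm_of_nonneg_of_le (Finset.sum_nonneg fun i _ => hf i)
    (Finset.sum_le_sum fun i _ => hfg i)

theorem CStarModule.DirectSum.coe_smul_mono {A : Type*} [NonUnitalCStarAlgebra A] [PartialOrder A]
    [StarOrderedRing A] {a b : A} (h : a ≤ b) (hb : 0 ≤ b) {r s : ℝ} (hr : 0 ≤ r) (hrs : r ≤ s) :
    (r : ℂ) • a ≤ (s : ℂ) • b := by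
  rw [Complex.coe_smul, Complex.coe_smul]
  exact (smul_le_smul_of_nonneg_left h hr).trans (smul_le_smul_of_nonneg_right hrs hb)

namespace CStarPrecategory

variable {O : Type u} {L : CStarPrecategory.{u, v} O}

theorem exists_norm_sq_sub {p q t : O} (c : L.Hom p q) (x : L.Hom q t) :
    ∃ (z : ℂ) (k : L.Hom q q), L.comp (L.adj (z • x + L.comp k x)) (z • x + L.comp k x) =
      ((‖c‖ ^ 2 : ℝ) : ℂ) • L.comp (L.adj x) x -
        L.comp (L.adj (L.comp c x)) (L.comp c x) := by
  let A := Unitization ℂ (L.Hom q q)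
  let _ : PartialOrder A := CStarAlgebra.spectralOrder A
  have _ : StarOrderedRing A := CStarAlgebra.spectralOrderedRing A
  obtain ⟨b, hb⟩ := L.exists_adj_comp_self c
  let B : A := (b : A)
  have hB : star B * B = ((L.comp (L.adj c) c : L.Hom q q) : A) := by
    rw [hb]
    exact ((Unitization.inr_mul ℂ (star b) b).trans (by rw [Unitization.inr_star])).symm
  have hn : ‖star B * B‖ = ‖c‖ ^ 2 := by
    rw [hB, Unitization.norm_inr, L.norm_adj_comp_self]
  have h0 : 0 ≤ algebraMap ℝ A (‖c‖ ^ 2) - star B * B := by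
    rw [sub_nonneg, ← hn]
    exact (IsSelfAdjoint.star_mul_self B).le_algebraMap_norm_self
  obtain ⟨d, hd⟩ := CStarAlgebra.nonneg_iff_eq_star_mul_self.1 h0
  rw [hB] at hd
  have hd' : algebraMap ℝ A (‖c‖ ^ 2) = star d * d +
      ((L.comp (L.adj c) c : L.Hom q q) : A) := by rw [← hd, sub_add_cancel]
  have h1 := congrArg (fun z : A => z.fst) hd'
  have h2 := congrArg (fun z : A => z.snd) hd'
  have e1 : star d.fst * d.fst = ((‖c‖ ^ 2 : ℝ) : ℂ) := by
    refine Eq.trans ?_ (h1.symm.trans ?_)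
    · exact (add_zero _).symm
    · change (Unitization.inl (algebraMap ℝ ℂ (‖c‖ ^ 2)) : A).fst = _
      rfl
  have e2 : star d.fst • d.snd + d.fst • L.adj d.snd + L.comp (L.adj d.snd) d.snd +
      L.comp (L.adj c) c = 0 := by
    refine Eq.trans ?_ (h2.symm.trans ?_)
    · rfl
    · change (Unitization.inl (algebraMap ℝ ℂ (‖c‖ ^ 2)) : A).snd = _
      rfl
  refine ⟨d.fst, d.snd, ?_⟩
  have e3 := congrArg (fun k => L.comp (L.adj x) (L.comp k x)) e2
  simp only [map_add, map_smul, map_zero, LinearMap.add_apply, LinearMap.smul_apply,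
    LinearMap.zero_apply, L.comp_assoc] at e3
  have e4 := eq_neg_of_add_eq_zero_left e3
  rw [← e1]
  simp only [map_add, LinearMap.map_smulₛₗ, LinearMap.add_apply, LinearMap.smul_apply,
    L.adj_comp, L.comp_assoc, sub_eq_add_neg, ← e4, mul_smul, map_smul]
  simp only [smul_add, starRingEnd_apply, add_assoc]
  rw [smul_comm d.fst (star d.fst)]
  abel

end CStarPrecategory

namespace CStarPrecategory.Ideal

variable {O : Type u} {L : CStarPrecategory.{u, v} O} (K : L.Ideal)

/-- Left multiplication of morphisms of an ideal by a morphism of the ambient precategory. -/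
noncomputable def lmul {p q t : O} (c : L.Hom p q) :
    K.toPrecategory.Hom q t →ₗ[ℂ] K.toPrecategory.Hom p t where
  toFun x := ⟨L.comp c x.1, K.comp_mem_left c x.2⟩
  map_add' x y := Subtype.ext (map_add (L.comp c) x.1 y.1)
  map_smul' z x := Subtype.ext (map_smul (L.comp c) z x.1)

theorem inner_lmul_left {p q t : O} (c : L.Hom p q) (x : K.toPrecategory.Hom q t)
    (y : K.toPrecategory.Hom p t) :
    inner (K.toPrecategory.diagSum)ᵐᵒᵖ (K.lmul c x) y =
      inner (K.toPrecategory.diagSum)ᵐᵒᵖ x (K.lmul (L.adj c) y) := by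
  rw [inner_hom, inner_hom]
  congr 2
  refine Subtype.ext ?_
  change L.comp (L.adj (L.comp c x.1)) y.1 = L.comp (L.adj x.1) (L.comp (L.adj c) y.1)
  rw [L.adj_comp, L.comp_assoc]

theorem inner_lmul_self_le {p q t : O} (c : L.Hom p q) (x : K.toPrecategory.Hom q t) {r : ℝ}
    (hr : ‖c‖ ≤ r) :
    inner (K.toPrecategory.diagSum)ᵐᵒᵖ (K.lmul c x) (K.lmul c x) ≤
      ((r ^ 2 : ℝ) : ℂ) • inner (K.toPrecategory.diagSum)ᵐᵒᵖ x x := by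
  obtain ⟨z, k, h⟩ := exists_norm_sq_sub c x.1
  have h1 := K.toPrecategory.op_single_adj_comp_self_nonneg (z • x + K.lmul k x)
  have h2 : K.toPrecategory.comp (K.toPrecategory.adj (z • x + K.lmul k x)) (z • x + K.lmul k x) =
      ((‖c‖ ^ 2 : ℝ) : ℂ) • K.toPrecategory.comp (K.toPrecategory.adj x) x -
        K.toPrecategory.comp (K.toPrecategory.adj (K.lmul c x)) (K.lmul c x) := Subtype.ext h
  rw [h2, map_sub, map_smul, MulOpposite.op_sub, MulOpposite.op_smul, sub_nonneg] at h1
  refine h1.trans ?_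
  exact CStarModule.DirectSum.coe_smul_mono le_rfl (K.toPrecategory.op_single_adj_comp_self_nonneg x)
    (by positivity) (by gcongr)

end CStarPrecategory.Ideal

namespace RightTensorPrecategory

open CStarPrecategory

variable {P : Type u} [Monoid P] {L : RightTensorPrecategory.{u, v} P} (K : L.Ideal)

open Classical in
/-- The action of `a ∈ L(p,q)` on families `x` with `x (s,t) ∈ K(s,t)`: the component of `a x` at
`(pv, t)` is `(a ⊗ 1_v) x (qv, t)`, and the components at `(u, t)` with `u ∉ pP` vanish. -/
noncomputable def fockFun {p q : P} (a : L.Hom p q)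
    (x : ∀ i : P × P, K.toPrecategory.Hom i.1 i.2) (i : P × P) : K.toPrecategory.Hom i.1 i.2 :=
  if h : ∃ v, p * v = i.1 then
    K.toPrecategory.castHom h.choose_spec rfl
      (K.lmul (L.tens h.choose a) (x (q * h.choose, i.2)))
  else 0

variable [IsLeftCancelMul P]

theorem fockFun_mul {p q : P} (a : L.Hom p q)
    (x : ∀ i : P × P, K.toPrecategory.Hom i.1 i.2) (v t : P) :
    fockFun K a x (p * v, t) = K.lmul (L.tens v a) (x (q * v, t)) := by
  have h : ∃ v', p * v' = (p * v, t).1 := ⟨v, rfl⟩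
  have key : ∀ (v' : P) (h' : p * v' = p * v), K.toPrecategory.castHom h' rfl
      (K.lmul (L.tens v' a) (x (q * v', t))) = K.lmul (L.tens v a) (x (q * v, t)) := by
    intro v' h'
    obtain rfl := mul_left_cancel h'
    rfl
  rw [fockFun, dif_pos h]
  exact key _ h.choose_spec

theorem fockFun_of_notMem {p q : P} (a : L.Hom p q)
    (x : ∀ i : P × P, K.toPrecategory.Hom i.1 i.2) {i : P × P} (h : i.1 ∉ rightIdeal p) :
    fockFun K a x i = 0 := dif_neg h

theorem fockFun_linear {p q : P} (a b : L.Hom p q) (c : ℂ)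
    (x : ∀ i : P × P, K.toPrecategory.Hom i.1 i.2) (i : P × P) :
    fockFun K (c • a + b) x i = c • fockFun K a x i + fockFun K b x i := by
  by_cases h : i.1 ∈ rightIdeal p
  · obtain ⟨u, t⟩ := i
    obtain ⟨v, rfl⟩ := h
    simp only [fockFun_mul]
    refine Subtype.ext ?_
    change L.comp (L.tens v (c • a + b)) (x (q * v, t)).1 =
      c • L.comp (L.tens v a) (x (q * v, t)).1 + L.comp (L.tens v b) (x (q * v, t)).1
    simp only [map_add, map_smul, LinearMap.add_apply, LinearMap.smul_apply]
  · simp only [fockFun_of_notMem K _ _ h, smul_zero, add_zero]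

theorem injective_mul_prod (p : P) : Function.Injective fun i : P × P => (p * i.1, i.2) :=
  fun i j h => Prod.ext (mul_left_cancel (congrArg Prod.fst h)) (congrArg Prod.snd h :)

theorem notMem_of_notMem_range {p : P} {i : P × P}
    (h : i ∉ Set.range fun i : P × P => (p * i.1, i.2)) : i.1 ∉ rightIdeal p :=
  fun ⟨v, hv⟩ => h ⟨(v, i.2), Prod.ext hv rfl⟩

theorem inner_fockFun_self_le {p q : P} (a : L.Hom p q)
    (x : ∀ i : P × P, K.toPrecategory.Hom i.1 i.2) (i : P × P) :
    inner (K.toPrecategory.diagSum)ᵐᵒᵖ (fockFun K a x (p * i.1, i.2))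
      (fockFun K a x (p * i.1, i.2)) ≤
    ((‖a‖ ^ 2 : ℝ) : ℂ) • inner (K.toPrecategory.diagSum)ᵐᵒᵖ (x (q * i.1, i.2))
      (x (q * i.1, i.2)) := by
  rw [fockFun_mul]
  exact K.inner_lmul_self_le _ _ (L.norm_tens_le _ a)

theorem summable_fockFun {p q : P} (a : L.Hom p q) (x : K.toPrecategory.FockModule) :
    Summable fun i => inner (K.toPrecategory.diagSum)ᵐᵒᵖ (fockFun K a x.1 i)
      (fockFun K a x.1 i) := by
  refine ((injective_mul_prod p).summable_iff fun i hi => ?_).1 ?_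
  · rw [fockFun_of_notMem K a _ (notMem_of_notMem_range hi), CStarModule.inner_zero_right]
  · refine CStarModule.DirectSum.summable_of_le (fun i => CStarModule.inner_self_nonneg)
      (inner_fockFun_self_le K a x.1) ?_
    exact ((x.summable_self.comp_injective (injective_mul_prod q)).const_smul _)

/-- The operator `T̄_{p,q}(a)` on the Fock module of `K`. -/
noncomputable def fockMap {p q : P} (a : L.Hom p q) (x : K.toPrecategory.FockModule) :
    K.toPrecategory.FockModule := ⟨fockFun K a x.1, summable_fockFun K a x⟩

theorem inner_fockMap_left {p q : P} (a : L.Hom p q) (x y : K.toPrecategory.FockModule) :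
    inner (K.toPrecategory.diagSum)ᵐᵒᵖ (fockMap K a x) y =
      ∑' i : P × P, inner (K.toPrecategory.diagSum)ᵐᵒᵖ (K.lmul (L.tens i.1 a)
        (x.1 (q * i.1, i.2))) (y.1 (p * i.1, i.2)) := by
  rw [CStarModule.DirectSum.inner_def, ← (injective_mul_prod p).tsum_eq]
  · exact tsum_congr fun i => by
      rw [← fockFun_mul]; rfl
  · intro i hi
    by_contra h
    refine hi ?_
    change inner _ (fockFun K a x.1 i) _ = _
    rw [fockFun_of_notMem K a _ (notMem_of_notMem_range h), CStarModule.inner_zero_left]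

theorem inner_fockMap {p q : P} (a : L.Hom p q) (x y : K.toPrecategory.FockModule) :
    inner (K.toPrecategory.diagSum)ᵐᵒᵖ (fockMap K a x) y =
      inner (K.toPrecategory.diagSum)ᵐᵒᵖ x (fockMap K (L.adj a) y) := by
  rw [← CStarModule.star_inner (fockMap K (L.adj a) y), inner_fockMap_left, inner_fockMap_left,
    tsum_star]
  refine tsum_congr fun i => ?_
  rw [CStarModule.star_inner, K.inner_lmul_left, L.tens_adj]

theorem norm_fockMap_le {p q : P} (a : L.Hom p q) (x : K.toPrecategory.FockModule) :
    ‖fockMap K a x‖ ≤ ‖a‖ * ‖x‖ := by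
  have h0 : ∀ y : K.toPrecategory.FockModule, 0 ≤ inner (K.toPrecategory.diagSum)ᵐᵒᵖ y y :=
    fun y => CStarModule.inner_self_nonneg
  have h1 : inner (K.toPrecategory.diagSum)ᵐᵒᵖ (fockMap K a x) (fockMap K a x) ≤
      ((‖a‖ ^ 2 : ℝ) : ℂ) • inner (K.toPrecategory.diagSum)ᵐᵒᵖ x x := by
    have hs := (x.summable_self.comp_injective (injective_mul_prod q))
    have hs' := (summable_fockFun K a x).comp_injective (injective_mul_prod p)
    have h2 : inner (K.toPrecategory.diagSum)ᵐᵒᵖ (fockMap K a x) (fockMap K a x) =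
        ∑' i : P × P, inner (K.toPrecategory.diagSum)ᵐᵒᵖ (fockFun K a x.1 (p * i.1, i.2))
          (fockFun K a x.1 (p * i.1, i.2)) := by
      rw [inner_fockMap_left]
      refine tsum_congr fun i => ?_
      change inner _ _ (fockFun K a x.1 (p * i.1, i.2)) = _
      rw [fockFun_mul]
    have h3 : ∑' i : P × P, inner (K.toPrecategory.diagSum)ᵐᵒᵖ (x.1 (q * i.1, i.2))
        (x.1 (q * i.1, i.2)) ≤ inner (K.toPrecategory.diagSum)ᵐᵒᵖ x x :=
      hs.tsum_le_tsum_of_inj _ (injective_mul_prod q)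
        (fun _ _ => CStarModule.inner_self_nonneg) (fun _ => le_rfl) x.summable_self
    rw [h2]
    refine (hs'.tsum_le_tsum (inner_fockFun_self_le K a x.1) (hs.const_smul _)).trans ?_
    refine (hs.tsum_const_smul ((‖a‖ ^ 2 : ℝ) : ℂ)).le.trans ?_
    exact CStarModule.DirectSum.coe_smul_mono h3 (h0 x) (by positivity) le_rfl
  refine (abs_le_of_sq_le_sq' ?_ (by positivity)).2
  rw [mul_pow, CStarModule.norm_sq_eq (K.toPrecategory.diagSum)ᵐᵒᵖ (x := fockMap K a x),
    CStarModule.norm_sq_eq (K.toPrecategory.diagSum)ᵐᵒᵖ (x := x)]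
  refine (CStarAlgebra.norm_le_norm_of_nonneg_of_le (h0 _) h1).trans ?_
  rw [norm_smul]
  refine le_of_eq ?_
  congr 1
  simp

/-- The operator `T̄_{p,q}(a)` on the Fock module of `K`, as a bounded operator. -/
noncomputable def fockCLM {p q : P} (a : L.Hom p q) :
    K.toPrecategory.FockModule →L[ℂ] K.toPrecategory.FockModule :=
  LinearMap.mkContinuous
    { toFun := fockMap K a
      map_add' := fun x y => CStarModule.ext_inner (A := (K.toPrecategory.diagSum)ᵐᵒᵖ) fun z => by
        have h := fun w => inner_fockMap K (L.adj a) z w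
        simp only [L.adj_adj] at h
        simp only [CStarModule.inner_add_right, ← h]
      map_smul' := fun c x => CStarModule.ext_inner (A := (K.toPrecategory.diagSum)ᵐᵒᵖ) fun z => by
        have h := fun w => inner_fockMap K (L.adj a) z w
        simp only [L.adj_adj] at h
        simp only [CStarModule.inner_smul_right_complex, ← h, RingHom.id_apply] }
    ‖a‖ (norm_fockMap_le K a)

/-- The operator `T̄_{p,q}(a)` on the Fock module of `K`, as an adjointable operator. -/
noncomputable def fockOp {p q : P} (a : L.Hom p q) : K.toPrecategory.FockAlgebra :=
  ⟨fockCLM K a, fockCLM K (L.adj a), inner_fockMap K a⟩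

theorem fockOp_apply {p q : P} (a : L.Hom p q) (x : K.toPrecategory.FockModule) (i : P × P) :
    ((fockOp K a).1 x).1 i = fockFun K a x.1 i := rfl

theorem fockOp_ext {S R : K.toPrecategory.FockAlgebra} (h : ∀ x i, (S.1 x).1 i = (R.1 x).1 i) :
    S = R :=
  Subtype.ext <| ContinuousLinearMap.ext fun x => CStarModule.DirectSum.ext fun i => h x i

theorem star_fockOp {p q : P} (a : L.Hom p q) : star (fockOp K a) = fockOp K (L.adj a) :=
  CStarModule.star_eq_of_adjoint (A := (K.toPrecategory.diagSum)ᵐᵒᵖ)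
    (E := K.toPrecategory.FockModule) (S := fockOp K a) (R := fockOp K (L.adj a))
    (inner_fockMap K a)

theorem fockOp_comp {p q s : P} (a : L.Hom p q) (b : L.Hom q s) :
    fockOp K (L.comp a b) = fockOp K a * fockOp K b := by
  refine fockOp_ext K fun x i => ?_
  change fockFun K (L.comp a b) x.1 i = fockFun K a (fockFun K b x.1) i
  by_cases h : i.1 ∈ rightIdeal p
  · obtain ⟨u, t⟩ := i
    obtain ⟨v, rfl⟩ := h
    simp only [fockFun_mul]
    refine Subtype.ext ?_
    change L.comp (L.tens v (L.comp a b)) _ = L.comp (L.tens v a) (L.comp (L.tens v b) _)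
    rw [L.tens_comp, L.comp_assoc]
  · rw [fockFun_of_notMem K _ _ h, fockFun_of_notMem K _ _ h]

/-- The Fock representation `T` of an ideal `K` in a right-tensor `C^*`-precategory. -/
noncomputable def fock : K.toPrecategory.Representation K.toPrecategory.FockAlgebra where
  toFun p q :=
    { toFun := fun a => fockOp K a.1
      map_add' := fun a b => fockOp_ext K fun x i => by
        have h := fockFun_linear K a.1 b.1 1 x.1 i
        rw [one_smul, one_smul] at h
        exact h
      map_smul' := fun c a => fockOp_ext K fun x i => by
        have h := fockFun_linear K a.1 0 c x.1 i
        have h0 := fockFun_linear K (p := p) (q := q) 0 0 1 x.1 i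
        rw [one_smul, one_smul, add_zero, left_eq_add] at h0
        rw [add_zero, h0, add_zero] at h
        exact h }
  map_adj a := (star_fockOp K a.1).symm
  map_comp a b := fockOp_comp K a.1 b.1

end RightTensorPrecategory

namespace RightTensorPrecategory

open CStarPrecategory

variable {P : Type u} [Monoid P] {L : RightTensorPrecategory.{u, v} P} {K : L.Ideal}

theorem comp_heq {σ σ' ρ ρ' τ τ' : P} (h : σ = σ') (h' : ρ = ρ') (h'' : τ = τ')
    {a : L.Hom σ ρ} {a' : L.Hom σ' ρ'} {b : L.Hom ρ τ} {b' : L.Hom ρ' τ'}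
    (ha : HEq a a') (hb : HEq b b') : HEq (L.comp a b) (L.comp a' b') := by
  subst h; subst h'; subst h''; rw [eq_of_heq ha, eq_of_heq hb]

theorem tens_heq {σ σ' ρ ρ' : P} (h : σ = σ') (h' : ρ = ρ') (r : P)
    {a : L.Hom σ ρ} {a' : L.Hom σ' ρ'} (ha : HEq a a') : HEq (L.tens r a) (L.tens r a') := by
  subst h; subst h'; rw [eq_of_heq ha]

theorem coe_heq (x : ∀ i : P × P, K.toPrecategory.Hom i.1 i.2) {i j : P × P} (h : i = j) :
    HEq (x i).1 (x j).1 := by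
  subst h; rfl

theorem isNicaCovariant_fock [RightLCMSemigroup P] (hK : L.IsWellAligned K) :
    IsNicaCovariant hK (fock K) := by
  have F := @fockFun_mul P _ L K _
  have F0 := @fockFun_of_notMem P _ L K _
  have F' : ∀ {p q : P} (a : L.Hom p q) (x : ∀ i : P × P, K.toPrecategory.Hom i.1 i.2)
      (u v t : P), p * v = u →
      HEq (fockFun K a x (u, t)).1 (L.comp (L.tens v a) (x (q * v, t)).1) := by
    intro p q a x u v t h
    subst h
    rw [F]
    rfl
  intro p q s t a b
  refine ⟨fun r v w hv hw hr => fockOp_ext K fun x i => ?_, fun hr => fockOp_ext K fun x i => ?_⟩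
  · change fockFun K a.1 (fockFun K b.1 x.1) i = fockFun K (hK.prod hv hw hr a b).1 x.1 i
    obtain ⟨u, τ⟩ := i
    by_cases h : u ∈ rightIdeal (p * v)
    · obtain ⟨y, rfl⟩ := h
      refine Subtype.ext (eq_of_heq ?_)
      have h1 := F' a.1 (fockFun K b.1 x.1) (p * v * y) (v * y) τ (mul_assoc _ _ _).symm
      have hsw : s * (w * y) = q * (v * y) := by rw [← mul_assoc, hw, ← hv, mul_assoc]
      have h2 := F' b.1 x.1 (q * (v * y)) (w * y) τ hsw
      have h3 := F' (hK.prod hv hw hr a b).1 x.1 (p * v * y) y τ rfl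
      refine h1.trans (HEq.trans ?_ h3.symm)
      have e : L.tens y (hK.prod hv hw hr a b).1 =
        L.comp (L.tens y (L.castHom rfl hv (L.tens v a.1)))
          (L.tens y (L.castHom hw rfl (L.tens w b.1))) := L.tens_comp _ _ _
      rw [e, L.comp_assoc]
      have hq : q * (v * y) = r * y := by rw [← mul_assoc, hv]
      refine comp_heq (mul_assoc _ _ _).symm hq rfl ?_ ?_
      · refine (L.tens_tens v y a.1).symm.trans ?_
        exact (tens_heq rfl hv.symm y (castHom_heq _ _ _)).symm
      · refine h2.trans ?_
        refine comp_heq (hsw.trans hq) (mul_assoc _ _ _).symm rfl ?_ ?_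
        · refine (L.tens_tens w y b.1).symm.trans ?_
          exact (tens_heq hw.symm rfl y (castHom_heq _ _ _)).symm
        · exact coe_heq x.1 (by rw [mul_assoc])
    · rw [F0 _ _ (i := (u, τ)) h]
      by_cases h' : u ∈ rightIdeal p
      · obtain ⟨y, rfl⟩ := h'
        rw [F, F0 b.1 x.1 (i := (q * y, τ)), map_zero]
        rintro ⟨z, hz⟩
        have : q * y ∈ rightIdeal r := by
          rw [← hr]; exact ⟨⟨y, rfl⟩, ⟨z, hz⟩⟩
        obtain ⟨y', hy'⟩ := this
        refine h ⟨y', ?_⟩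
        change p * v * y' = p * y
        change r * y' = q * y at hy'
        rw [← hv, mul_assoc] at hy'
        rw [mul_assoc, mul_left_cancel hy']
      · rw [F0 _ _ (i := (u, τ)) h']
  · change fockFun K a.1 (fockFun K b.1 x.1) i = 0
    obtain ⟨u, τ⟩ := i
    by_cases h' : u ∈ rightIdeal p
    · obtain ⟨y, rfl⟩ := h'
      rw [F, F0 b.1 x.1 (i := (q * y, τ)), map_zero]
      rintro ⟨z, hz⟩
      rcases RightLCMSemigroup.inter_rightIdeal q s with h | ⟨r, h⟩
      · exact Set.notMem_empty (q * y) (h ▸ ⟨⟨y, rfl⟩, ⟨z, hz⟩⟩)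
      · exact hr r h
    · rw [F0 _ _ (i := (u, τ)) h']

end RightTensorPrecategory

theorem NonUnitalCStarAlgebra.exists_small_copy (B : Type w) [NonUnitalCStarAlgebra B]
    [Small.{u} B] : ∃ (A : Type u) (_ : NonUnitalCStarAlgebra A), Nonempty (A ≃⋆ₐ[ℂ] B) := by
  let A := Shrink.{u} B
  let e : A ≃ B := (equivShrink B).symm
  let _ : NonUnitalRing A := e.nonUnitalRing
  let _ : Star A := ⟨fun a => e.symm (star (e a))⟩
  let _ : Module ℂ A := e.module ℂ
  have hs : ∀ a : A, e (star a) = star (e a) := fun a => e.apply_symm_apply _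
  have hz : ∀ (c : ℂ) (a : A), e (c • a) = c • e a := fun c a => e.apply_symm_apply _
  have hm : ∀ a b : A, e (a * b) = e a * e b := fun a b => e.apply_symm_apply _
  have hadd : ∀ a b : A, e (a + b) = e a + e b := fun a b => e.apply_symm_apply _
  let f : A →ₙ+* B := { toFun := e, map_mul' := hm, map_add' := hadd, map_zero' := e.apply_symm_apply _ }
  let nr : NonUnitalNormedRing A := NonUnitalNormedRing.induced A B f e.injective
  have hn : ∀ a : A, ‖a‖ = ‖e a‖ := fun a => rfl
  have iso : Isometry e := AddMonoidHomClass.isometry_of_norm f fun a => (hn a).symm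
  have cmp : CompleteSpace A :=
    (completeSpace_congr (e := e) iso.isUniformEmbedding).2 inferInstance
  let _ : NonUnitalCStarAlgebra A :=
    { nr, cmp, (inferInstance : Module ℂ A) with
      star_involutive := fun a => e.injective (by rw [hs, hs, star_star])
      star_mul := fun a b => e.injective (by rw [hs, hm, hm, hs, hs, star_mul])
      star_add := fun a b => e.injective (by rw [hs, hadd, hadd, hs, hs, star_add])
      star_smul := fun c a => e.injective (by rw [hs, hz, hz, hs, star_smul])
      norm_mul_self_le := fun a => by
        rw [hn, hn, hm, hs]; exact CStarRing.norm_mul_self_le (e a)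
      smul_assoc := fun c a b => e.injective (by
        rw [smul_eq_mul, smul_eq_mul, hm, hz, hz, hm, smul_mul_assoc])
      smul_comm := fun c a b => e.injective (by
        rw [smul_eq_mul, smul_eq_mul, hm, hz, hz, hm, mul_smul_comm])
      norm_smul_le := fun c a => by rw [hn, hz, norm_smul, hn] }
  exact ⟨A, inferInstance, ⟨{ e with
    map_mul' := hm, map_add' := hadd, map_star' := hs, map_smul' := hz }⟩⟩

theorem small_closure_span {B : Type w} [NormedAddCommGroup B] [NormedSpace ℂ B] (S : Set B)
    [Small.{u} S] : Small.{u} (closure (Submodule.span ℂ S : Set B)) := by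
  have h1 : Small.{u} (Submodule.span ℂ S : Set B) := by
    have e : (Submodule.span ℂ S : Set B) =
        Set.range fun l : List (ℂ × S) => (l.map fun x => x.1 • (x.2 : B)).sum := by
      refine Set.Subset.antisymm (fun x hx => ?_) ?_
      · induction hx using Submodule.span_induction with
        | mem x h => exact ⟨[(1, ⟨x, h⟩)], by simp⟩
        | zero => exact ⟨[], by simp⟩
        | add x y _ _ hx hy =>
          obtain ⟨l, rfl⟩ := hx
          obtain ⟨l', rfl⟩ := hy
          exact ⟨l ++ l', by simp⟩
        | smul c x _ hx =>
          obtain ⟨l, rfl⟩ := hx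
          refine ⟨l.map fun x => (c * x.1, x.2), ?_⟩
          simp [List.smul_sum, Function.comp_def, mul_smul]
      · rintro _ ⟨l, rfl⟩
        refine list_sum_mem fun x hx => ?_
        obtain ⟨y, -, rfl⟩ := List.mem_map.1 hx
        exact Submodule.smul_mem _ _ (Submodule.subset_span y.2.2)
    rw [e]
    infer_instance
  have h2 : closure (Submodule.span ℂ S : Set B) ⊆
      Set.range fun s : ℕ → (Submodule.span ℂ S : Set B) =>
        Filter.limUnder Filter.atTop fun n => (s n : B) := by
    intro x hx
    obtain ⟨s, hs, hx⟩ := mem_closure_iff_seq_limit.1 hx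
    exact ⟨fun n => ⟨s n, hs n⟩, hx.limUnder_eq⟩
  exact small_subset h2

/-- The linear span of a self-adjoint set that is closed under multiplication up to linear
combinations, as a `*`-algebra. -/
def NonUnitalStarSubalgebra.ofSpan {B : Type w} [NonUnitalCStarAlgebra B] (S : Set B)
    (hm : ∀ a ∈ S, ∀ b ∈ S, a * b ∈ Submodule.span ℂ S) (hs : ∀ a ∈ S, star a ∈ S) :
    NonUnitalStarSubalgebra ℂ B where
  toSubmodule := Submodule.span ℂ S
  mul_mem' {a b} ha hb := by
    change a * b ∈ Submodule.span ℂ S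
    induction ha, hb using Submodule.span_induction₂ with
    | mem_mem a b ha hb => exact hm a ha b hb
    | zero_left b hb => simp
    | zero_right a ha => simp
    | add_left a a' b _ _ _ h h' => rw [add_mul]; exact add_mem h h'
    | add_right a b b' _ _ _ h h' => rw [mul_add]; exact add_mem h h'
    | smul_left c a b _ _ h => rw [smul_mul_assoc]; exact Submodule.smul_mem _ _ h
    | smul_right c a b _ _ h => rw [mul_smul_comm]; exact Submodule.smul_mem _ _ h
  star_mem' {a} ha := by
    change star a ∈ Submodule.span ℂ S
    induction ha using Submodule.span_induction with
    | mem a ha => exact Submodule.subset_span (hs a ha)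
    | zero => simp
    | add a a' _ _ h h' => rw [star_add]; exact add_mem h h'
    | smul c a _ h => rw [star_smul]; exact Submodule.smul_mem _ _ h

namespace RightTensorPrecategory

open CStarPrecategory

section Core

variable {P : Type u} [Monoid P] {L : RightTensorPrecategory.{u, v} P}
  {K : L.Ideal} {hK : L.IsWellAligned K} {B : Type w} [NonUnitalCStarAlgebra B]
  {Φ : K.toPrecategory.Representation B}

theorem IsNicaCovariant.mul_mem_span (hΦ : IsNicaCovariant hK Φ) :
    ∀ a ∈ ⋃ i : P × P, Set.range (Φ.toFun i.1 i.2), ∀ b ∈ ⋃ i : P × P, Set.range (Φ.toFun i.1 i.2),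
      a * b ∈ Submodule.span ℂ (⋃ i : P × P, Set.range (Φ.toFun i.1 i.2)) := by
  intro a ha b hb
  obtain ⟨⟨p, q⟩, a, rfl⟩ := Set.mem_iUnion.1 ha
  obtain ⟨⟨s, t⟩, b, rfl⟩ := Set.mem_iUnion.1 hb
  have h := hΦ p q s t a b
  by_cases hr : ∃ r, rightIdeal q ∩ rightIdeal s = rightIdeal r
  · obtain ⟨r, hr⟩ := hr
    have hm : r ∈ rightIdeal q ∩ rightIdeal s := hr ▸ ⟨1, mul_one r⟩
    obtain ⟨⟨v, hv⟩, ⟨w, hw⟩⟩ := hm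
    refine Submodule.subset_span (Set.mem_iUnion.2 ⟨(p * v, t * w), ?_⟩)
    exact ⟨_, (h.1 r v w hv hw hr).symm⟩
  · rw [h.2 fun r hr' => hr ⟨r, hr'⟩]
    exact zero_mem _

theorem IsNicaCovariant.mul_mem_span_diag (hΦ : IsNicaCovariant hK Φ) :
    ∀ a ∈ ⋃ p : P, Set.range (Φ.toFun p p), ∀ b ∈ ⋃ p : P, Set.range (Φ.toFun p p),
      a * b ∈ Submodule.span ℂ (⋃ p : P, Set.range (Φ.toFun p p)) := by
  intro a ha b hb
  obtain ⟨p, a, rfl⟩ := Set.mem_iUnion.1 ha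
  obtain ⟨s, b, rfl⟩ := Set.mem_iUnion.1 hb
  have h := hΦ p p s s a b
  by_cases hr : ∃ r, rightIdeal p ∩ rightIdeal s = rightIdeal r
  · obtain ⟨r, hr⟩ := hr
    have hm : r ∈ rightIdeal p ∩ rightIdeal s := hr ▸ ⟨1, mul_one r⟩
    obtain ⟨⟨v, hv⟩, ⟨w, hw⟩⟩ := hm
    have e := h.1 r v w hv hw hr
    have key : ∀ (x y : P) (_ : x = y) (c : K.toPrecategory.Hom x y), Φ.toFun x y c ∈
        Submodule.span ℂ (⋃ p : P, Set.range (Φ.toFun p p)) := by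
      rintro x _ rfl c
      exact Submodule.subset_span (Set.mem_iUnion.2 ⟨x, c, rfl⟩)
    rw [e]
    exact key _ _ (hv.trans hw.symm) _
  · rw [h.2 fun r hr' => hr ⟨r, hr'⟩]
    exact zero_mem _

/-- The core `B_e^Φ` of a Nica covariant representation `Φ`: the closed linear span of the
spaces `Φ(K(p,p))`, as a `C^*`-algebra. -/
def IsNicaCovariant.core (hΦ : IsNicaCovariant hK Φ) : NonUnitalStarSubalgebra ℂ B :=
  (NonUnitalStarSubalgebra.ofSpan (⋃ p : P, Set.range (Φ.toFun p p)) hΦ.mul_mem_span_diag (by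
    intro a ha
    obtain ⟨p, a, rfl⟩ := Set.mem_iUnion.1 ha
    exact Set.mem_iUnion.2 ⟨p, K.toPrecategory.adj a, Φ.map_adj a⟩)).topologicalClosure

theorem IsNicaCovariant.coe_core (hΦ : IsNicaCovariant hK Φ) : (hΦ.core : Set B) =
    closure (Submodule.span ℂ (⋃ p : P, Set.range (Φ.toFun p p)) : Set B) := rfl

theorem IsNicaCovariant.small_generated (hΦ : IsNicaCovariant hK Φ) :
    Small.{max u v} Φ.generated := by
  let S := ⋃ i : P × P, Set.range (Φ.toFun i.1 i.2)
  have hS : Small.{max u v} S := by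
    have : ∀ i : P × P, Small.{max u v} (Set.range (Φ.toFun i.1 i.2)) := fun i =>
      small_range _
    exact small_iUnion _
  have h := small_closure_span.{max u v} S
  let T := NonUnitalStarSubalgebra.ofSpan S hΦ.mul_mem_span (by
    intro a ha
    obtain ⟨i, a, rfl⟩ := Set.mem_iUnion.1 ha
    exact Set.mem_iUnion.2 ⟨(i.2, i.1), K.toPrecategory.adj a, Φ.map_adj a⟩)
  have hT : NonUnitalStarAlgebra.adjoin ℂ (⋃ (σ : P) (ρ : P), Set.range (Φ.toFun σ ρ)) ≤ T := by
    refine NonUnitalStarAlgebra.adjoin_le ?_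
    refine Set.iUnion_subset fun σ => Set.iUnion_subset fun ρ => ?_
    exact (Set.subset_iUnion (fun i : P × P => Set.range (Φ.toFun i.1 i.2)) (σ, ρ)).trans
      Submodule.subset_span
  have hc : (Φ.generated : Set B) ⊆ closure (Submodule.span ℂ S : Set B) := closure_mono hT
  exact small_subset hc

end Core

section Universal

variable {P : Type u} [Monoid P] {L : RightTensorPrecategory.{u, v} P}
  {K : L.Ideal} (hK : L.IsWellAligned K)

/-- The Nica covariant representations of `K` in `C^*`-algebras of the universe of `K`. -/
structure NicaIndex where
  B : Type (max u v)
  [cstar : NonUnitalCStarAlgebra B]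
  rep : K.toPrecategory.Representation B
  nica : IsNicaCovariant hK rep

attribute [instance] NicaIndex.cstar

/-- The direct sum of all Nica covariant representations indexed by `NicaIndex`. -/
noncomputable def sumRep :
    K.toPrecategory.Representation (lp (fun j : NicaIndex hK => j.B) ∞) where
  toFun p q :=
    { toFun := fun a => ⟨fun j => j.rep.toFun p q a, memℓp_infty
        ⟨‖a‖, by rintro _ ⟨j, rfl⟩; exact j.rep.norm_map_le a⟩⟩
      map_add' := fun a b => lp.ext (funext fun j => map_add (j.rep.toFun p q) a b)
      map_smul' := fun c a => lp.ext (funext fun j => map_smul (j.rep.toFun p q) c a) }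
  map_adj a := lp.ext (funext fun j => j.rep.map_adj a)
  map_comp a b := lp.ext (funext fun j => j.rep.map_comp a b)

/-- The Nica-Toeplitz algebra `NT_L(K)`: the universal `C^*`-algebra for Nica covariant
representations of `K`. -/
def NT : Type (max u v + 1) := (sumRep hK).generated

noncomputable instance : NonUnitalCStarAlgebra (NT hK) :=
  NonUnitalStarSubalgebra.nonUnitalCStarAlgebra (sumRep hK).generated
    (h_closed := NonUnitalStarSubalgebra.isClosed_topologicalClosure _)

theorem sumRep_mem {p q : P} (a : K.toPrecategory.Hom p q) :
    (sumRep hK).toFun p q a ∈ (sumRep hK).generated :=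
  NonUnitalStarSubalgebra.le_topologicalClosure _ (NonUnitalStarAlgebra.subset_adjoin ℂ _
    (Set.mem_iUnion.2 ⟨p, Set.mem_iUnion.2 ⟨q, a, rfl⟩⟩))

/-- The universal Nica covariant representation `i_K` of `K` in `NT_L(K)`. -/
noncomputable def universalRep : K.toPrecategory.Representation (NT hK) where
  toFun p q :=
    { toFun := fun a => ⟨(sumRep hK).toFun p q a, sumRep_mem hK a⟩
      map_add' := fun a b => Subtype.ext (map_add _ a b)
      map_smul' := fun c a => Subtype.ext (map_smul _ c a) }
  map_adj a := Subtype.ext ((sumRep hK).map_adj a)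
  map_comp a b := Subtype.ext ((sumRep hK).map_comp a b)

theorem isNicaCovariant_universalRep : IsNicaCovariant hK (universalRep hK) := fun p q s t a b =>
  ⟨fun r v w hv hw hr => Subtype.ext (lp.ext (funext fun j =>
      (j.nica p q s t a b).1 r v w hv hw hr)),
    fun hr => Subtype.ext (lp.ext (funext fun j => (j.nica p q s t a b).2 hr))⟩

variable {hK}

theorem exists_universal_hom {B : Type w} [NonUnitalCStarAlgebra B]
    {Φ : K.toPrecategory.Representation B} (hΦ : IsNicaCovariant hK Φ) :
    ∃ π : NT hK →⋆ₙₐ[ℂ] B, ∀ (p q : P) (a : K.toPrecategory.Hom p q),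
      π ((universalRep hK).toFun p q a) = Φ.toFun p q a := by
  have hsm := hΦ.small_generated
  let _ : NonUnitalCStarAlgebra Φ.generated :=
    NonUnitalStarSubalgebra.nonUnitalCStarAlgebra Φ.generated
      (h_closed := NonUnitalStarSubalgebra.isClosed_topologicalClosure _)
  obtain ⟨A, _, ⟨e⟩⟩ := NonUnitalCStarAlgebra.exists_small_copy.{max u v} Φ.generated
  have hmem : ∀ {p q : P} (a : K.toPrecategory.Hom p q), Φ.toFun p q a ∈ Φ.generated := fun a =>
    NonUnitalStarSubalgebra.le_topologicalClosure _ (NonUnitalStarAlgebra.subset_adjoin ℂ _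
      (Set.mem_iUnion.2 ⟨_, Set.mem_iUnion.2 ⟨_, a, rfl⟩⟩))
  let Ψ : K.toPrecategory.Representation A :=
    { toFun := fun p q =>
        { toFun := fun a => e.symm ⟨Φ.toFun p q a, hmem a⟩
          map_add' := fun a b => by
            rw [← map_add e.symm]; congr 1; exact Subtype.ext (map_add _ a b)
          map_smul' := fun c a => by
            rw [RingHom.id_apply, ← map_smul e.symm]; congr 1
            exact Subtype.ext (map_smul _ c a) }
      map_adj := fun a => (congrArg e.symm (Subtype.ext (Φ.map_adj a))).trans
        (map_star e.symm ⟨_, hmem a⟩)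
      map_comp := fun a b => (congrArg e.symm (Subtype.ext (Φ.map_comp a b))).trans
        (map_mul e.symm ⟨_, hmem a⟩ ⟨_, hmem b⟩) }
  have hΨ : IsNicaCovariant hK Ψ := fun p q s t a b =>
    ⟨fun r v w hv hw hr => (map_mul e.symm ⟨_, hmem a⟩ ⟨_, hmem b⟩).symm.trans
        (congrArg e.symm (Subtype.ext ((hΦ p q s t a b).1 r v w hv hw hr))),
      fun hr => (map_mul e.symm ⟨_, hmem a⟩ ⟨_, hmem b⟩).symm.trans
        ((congrArg e.symm (Subtype.ext ((hΦ p q s t a b).2 hr))).trans (map_zero e.symm))⟩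
  let j : NicaIndex hK := ⟨A, Ψ, hΨ⟩
  refine ⟨
    { toFun := fun x => (e (x.1.1 j)).1
      map_smul' := fun c x => by
        change (e (c • x.1.1 j)).1 = _
        rw [map_smul]; rfl
      map_zero' := congrArg Subtype.val (map_zero e)
      map_add' := fun x y => congrArg Subtype.val (map_add e (x.1.1 j) (y.1.1 j))
      map_mul' := fun x y => congrArg Subtype.val (map_mul e (x.1.1 j) (y.1.1 j))
      map_star' := fun x => congrArg Subtype.val (map_star e (x.1.1 j)) }, fun p q a => ?_⟩
  exact congrArg Subtype.val (e.apply_symm_apply ⟨Φ.toFun p q a, hmem a⟩)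

/-- The integrated form `Φ ⋊ P : NT_L(K) → B` of a Nica covariant representation `Φ`. -/
noncomputable def IsNicaCovariant.integrated {B : Type w}
    [NonUnitalCStarAlgebra B] {Φ : K.toPrecategory.Representation B}
    (hΦ : IsNicaCovariant hK Φ) : NT hK →⋆ₙₐ[ℂ] B := (exists_universal_hom hΦ).choose

theorem IsNicaCovariant.integrated_apply {B : Type w}
    [NonUnitalCStarAlgebra B] {Φ : K.toPrecategory.Representation B}
    (hΦ : IsNicaCovariant hK Φ) {p q : P} (a : K.toPrecategory.Hom p q) :
    hΦ.integrated ((universalRep hK).toFun p q a) = Φ.toFun p q a :=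
  (exists_universal_hom hΦ).choose_spec p q a

theorem generated_universalRep : (universalRep hK).generated = ⊤ := by
  refine eq_top_iff.2 fun x _ => ?_
  let S : Set (lp (fun j : NicaIndex hK => j.B) ∞) :=
    ⋃ (σ : P) (ρ : P), Set.range ((sumRep hK).toFun σ ρ)
  let ι : NT hK →⋆ₙₐ[ℂ] lp (fun j : NicaIndex hK => j.B) ∞ :=
    NonUnitalStarSubalgebraClass.subtype (sumRep hK).generated
  have hS : NonUnitalStarAlgebra.adjoin ℂ S ≤ NonUnitalStarSubalgebra.map ι
      (NonUnitalStarAlgebra.adjoin ℂ (⋃ (σ : P) (ρ : P), Set.range ((universalRep hK).toFun σ ρ))) :=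
    NonUnitalStarAlgebra.adjoin_le <| Set.iUnion_subset fun σ => Set.iUnion_subset fun ρ => by
      rintro _ ⟨a, rfl⟩
      exact ⟨(universalRep hK).toFun σ ρ a, NonUnitalStarAlgebra.subset_adjoin ℂ _
        (Set.mem_iUnion.2 ⟨σ, Set.mem_iUnion.2 ⟨ρ, a, rfl⟩⟩), rfl⟩
  have hx : x.1 ∈ closure (NonUnitalStarAlgebra.adjoin ℂ S : Set _) := x.2
  refine Metric.mem_closure_iff.2 fun ε hε => ?_
  obtain ⟨_, hy, hxy⟩ := Metric.mem_closure_iff.1 hx ε hε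
  obtain ⟨y, hy', rfl⟩ := hS hy
  exact ⟨y, hy', hxy⟩

theorem universal_hom_unique {B : Type w} [NonUnitalCStarAlgebra B] {π π' : NT hK →⋆ₙₐ[ℂ] B}
    (h : ∀ (p q : P) (a : K.toPrecategory.Hom p q),
      π ((universalRep hK).toFun p q a) = π' ((universalRep hK).toFun p q a)) : π = π' := by
  have hc : ∀ f : NT hK →⋆ₙₐ[ℂ] B, Continuous f := fun f =>
    AddMonoidHomClass.continuous_of_bound f 1 fun x => by
      simpa using NonUnitalStarAlgHom.norm_apply_le f x
  have h1 : (universalRep hK).generated ≤ NonUnitalStarAlgHom.equalizer π π' :=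
    NonUnitalStarSubalgebra.topologicalClosure_minimal _
      (NonUnitalStarAlgebra.adjoin_le <| Set.iUnion_subset fun σ => Set.iUnion_subset fun ρ => by
        rintro _ ⟨a, rfl⟩
        exact h σ ρ a) (isClosed_eq (hc π) (hc π'))
  ext x
  exact h1 (generated_universalRep.ge trivial)

theorem IsNicaCovariant.integrated_mem_core {B : Type w} [NonUnitalCStarAlgebra B]
    {Φ : K.toPrecategory.Representation B} (hΦ : IsNicaCovariant hK Φ)
    {x : NT hK} (hx : x ∈ (isNicaCovariant_universalRep hK).core) :
    hΦ.integrated x ∈ hΦ.core := by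
  have hc : Continuous hΦ.integrated :=
    AddMonoidHomClass.continuous_of_bound hΦ.integrated 1 fun x => by
      simpa using NonUnitalStarAlgHom.norm_apply_le hΦ.integrated x
  refine map_mem_closure hc hx fun y hy => ?_
  change hΦ.integrated y ∈ Submodule.span ℂ (⋃ p : P, Set.range (Φ.toFun p p))
  change y ∈ Submodule.span ℂ (⋃ p : P, Set.range ((universalRep hK).toFun p p)) at hy
  induction hy using Submodule.span_induction with
  | mem y hy =>
    obtain ⟨p, a, rfl⟩ := Set.mem_iUnion.1 hy
    rw [integrated_apply]
    exact Submodule.subset_span (Set.mem_iUnion.2 ⟨p, a, rfl⟩)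
  | zero => rw [map_zero]; exact zero_mem _
  | add y z _ _ hy hz => rw [map_add]; exact add_mem hy hz
  | smul c y _ hy => rw [map_smul]; exact Submodule.smul_mem _ _ hy

/-- The restriction `B_e^{i_K} → B_e^Φ` of `Φ ⋊ P` to the cores. -/
noncomputable def IsNicaCovariant.integratedCore {B : Type w} [NonUnitalCStarAlgebra B]
    {Φ : K.toPrecategory.Representation B} (hΦ : IsNicaCovariant hK Φ) :
    (isNicaCovariant_universalRep hK).core →⋆ₙₐ[ℂ] hΦ.core :=
  NonUnitalStarAlgHom.codRestrict
    (hΦ.integrated.comp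
      (NonUnitalStarSubalgebraClass.subtype (isNicaCovariant_universalRep hK).core))
    hΦ.core fun x => hΦ.integrated_mem_core x.2

end Universal

end RightTensorPrecategory

/-!
Let `Ψ` be the universal representation and `π = Φ ⋊ P`, so that `π ∘ Ψ = Φ`.

Suppose first that `Φ` is injective and Toeplitz covariant. The core is the closure of the union of
the local cores `C_F = closure (∑ Ψ(K(q,q)), q ∈ F)` over the finite sets `F ⊆ P` that are closed
under least common multiples; by Nica covariance these are `C^*`-algebras, and
`exists_isJoinClosed` shows that there are enough of them. Since injective homomorphisms of
`C^*`-algebras are isometric, it is enough that `π` is injective on each `C_F`, which is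
`IsNicaCovariant.eq_zero_of_mem_localCore`. Let `π x = 0`, `p ∈ F` and `a ∈ K(p,p)`. Nica covariance
puts `Ψ(a) x` in the closure of `Ψ(K(p,p)) + C_G`, where `G` is the set of elements of `F` strictly
above `p`. Toeplitz covariance and injectivity of `Φ` give `‖d‖ ≤ ‖Φ(d) + π c‖` for `d ∈ K(p,p)` and
`c ∈ C_G` (`IsNicaCovariant.norm_le_norm_apply_add`, from `NonUnitalStarAlgHom.norm_le_norm_add`), so
`π (Ψ(a) x) = 0` forces `Ψ(a) x ∈ C_G`, and by induction `Ψ(a) x = 0`. As `a` and `p` are arbitrary,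
`C_F x = 0`, hence `x^* x = 0`. Multiplying by `Ψ(a)` first, rather than decomposing `x` itself,
allows for invertible elements of `P`: several `p' ∈ F` may generate the ideal `pP`, but
`Ψ(K(p,p)) Ψ(K(p',p')) ⊆ Ψ(K(p,p))`.

For the converse, injectivity and Toeplitz covariance pass from `Ψ` to `Φ` along a homomorphism that
is injective, hence isometric, on the core. So it remains that `Ψ` has both properties, and these it
inherits from the Fock representation `T`: the component of `T(a) a^*` at `(p,p)` is `a a^*`, while
the operators in `T(K(q,q))` have no components at `(p,p)` if `p ∉ qP`.
-/

/-! ### Isometries modulo a subalgebra -/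

section General

variable {A B : Type*} [NonUnitalCStarAlgebra A] [NonUnitalCStarAlgebra B]

theorem NonUnitalStarAlgHom.continuous_of_cstar (π : A →⋆ₙₐ[ℂ] B) : Continuous π :=
  AddMonoidHomClass.continuous_of_bound π 1 fun x => by
    simpa using NonUnitalStarAlgHom.norm_apply_le π x

theorem NonUnitalStarAlgHom.norm_map_of_mem (π : A →⋆ₙₐ[ℂ] B) (S : NonUnitalStarSubalgebra ℂ A)
    (hS : IsClosed (S : Set A)) (h : ∀ x ∈ S, π x = 0 → x = 0) {x : A} (hx : x ∈ S) :
    ‖π x‖ = ‖x‖ := by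
  let _ : NonUnitalCStarAlgebra S :=
    NonUnitalStarSubalgebra.nonUnitalCStarAlgebra S (h_closed := hS)
  let ρ : S →⋆ₙₐ[ℂ] B := π.comp (NonUnitalStarSubalgebraClass.subtype S)
  refine NonUnitalStarAlgHom.norm_map ρ ((injective_iff_map_eq_zero ρ).2 fun y hy => ?_) ⟨x, hx⟩
  exact Subtype.ext (h y.1 y.2 hy)

/-- If `I` is a closed `*`-subalgebra with `φ(A) I ⊆ I` and `φ⁻¹(I) = 0`, then `φ` remains isometric
modulo `I`. The pairs `(x, a)` with `x - φ a ∈ I` form a `C^*`-subalgebra of `B × A` on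
which the first projection is injective, hence isometric. -/
theorem NonUnitalStarAlgHom.norm_le_norm_add (φ : A →⋆ₙₐ[ℂ] B) (I : NonUnitalStarSubalgebra ℂ B)
    (hI : IsClosed (I : Set B)) (hl : ∀ a, ∀ c ∈ I, φ a * c ∈ I)
    (h : ∀ a, φ a ∈ I → a = 0) (a : A) {c : B} (hc : c ∈ I) : ‖a‖ ≤ ‖φ a + c‖ := by
  have hr : ∀ a, ∀ c ∈ I, c * φ a ∈ I := fun a c hc => by
    have := star_mem (hl (star a) (star c) (star_mem hc))
    rwa [star_mul, star_star, map_star, star_star] at this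
  let S : NonUnitalStarSubalgebra ℂ (B × A) :=
    { carrier := {z | z.1 - φ z.2 ∈ I}
      zero_mem' := by simp
      add_mem' := fun {y z} hy hz => by
        have := add_mem (S := NonUnitalStarSubalgebra ℂ B) (s := I) hy hz
        rwa [← add_sub_add_comm, ← map_add] at this
      smul_mem' := fun k z hz => by
        have := SMulMemClass.smul_mem (S := NonUnitalStarSubalgebra ℂ B) (s := I) k hz
        rwa [smul_sub, ← map_smul] at this
      mul_mem' := fun {y z} hy hz => by
        have e : (y * z).1 - φ (y * z).2 = (y.1 - φ y.2) * (z.1 - φ z.2) +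
            ((y.1 - φ y.2) * φ z.2 + φ y.2 * (z.1 - φ z.2)) := by
          rw [Prod.fst_mul, Prod.snd_mul, map_mul]
          noncomm_ring
        change (y * z).1 - φ (y * z).2 ∈ I
        rw [e]
        exact add_mem (mul_mem hy hz) (add_mem (hr _ _ hy) (hl _ _ hz))
      star_mem' := fun {z} hz => by
        have := star_mem (S := NonUnitalStarSubalgebra ℂ B) (s := I) hz
        rwa [star_sub, ← map_star] at this }
  have hS : IsClosed (S : Set (B × A)) :=
    hI.preimage (continuous_fst.sub (φ.continuous_of_cstar.comp continuous_snd))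
  have hx : (φ a + c, a) ∈ S := by
    change φ a + c - φ a ∈ I
    rwa [add_sub_cancel_left]
  have key := NonUnitalStarAlgHom.norm_map_of_mem (NonUnitalStarAlgHom.fst ℂ B A) S hS
    (fun z hz hz0 => by
      have h0 : z.1 = 0 := hz0
      have hz' : z.1 - φ z.2 ∈ I := hz
      rw [h0, zero_sub, neg_mem_iff] at hz'
      exact Prod.ext h0 (h _ hz')) hx
  exact (norm_snd_le (φ a + c, a)).trans_eq key.symm

end General

/-! ### Join-closed finite sets -/

section RightIdeals

variable {P : Type u} [Monoid P]

theorem self_mem_rightIdeal (p : P) : p ∈ rightIdeal p := ⟨1, mul_one p⟩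

theorem rightIdeal_subset_iff {p q : P} : rightIdeal p ⊆ rightIdeal q ↔ p ∈ rightIdeal q := by
  refine ⟨fun h => h (self_mem_rightIdeal p), ?_⟩
  rintro ⟨v, rfl⟩ _ ⟨w, rfl⟩
  exact ⟨v * w, (mul_assoc q v w).symm⟩

/-- A finite subset of `P` is join-closed if with `p` and `q` it contains some `r` with
`pP ∩ qP = rP`, unless `pP ∩ qP` is empty. Only one generator of `pP ∩ qP` is required, since `P`
may have infinitely many invertible elements. -/
def IsJoinClosed (F : Finset P) : Prop :=
  ∀ p ∈ F, ∀ q ∈ F, rightIdeal p ∩ rightIdeal q = ∅ ∨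
    ∃ r ∈ F, rightIdeal p ∩ rightIdeal q = rightIdeal r

open Classical in
/-- The elements of `F` that lie strictly above `p`. -/
noncomputable def strictlyAbove (F : Finset P) (p : P) : Finset P :=
  F.filter fun r => r ∈ rightIdeal p ∧ p ∉ rightIdeal r

theorem mem_strictlyAbove {F : Finset P} {p r : P} :
    r ∈ strictlyAbove F p ↔ r ∈ F ∧ r ∈ rightIdeal p ∧ p ∉ rightIdeal r := by
  classical exact Finset.mem_filter

theorem card_strictlyAbove_lt {F : Finset P} {p : P} (hp : p ∈ F) :
    (strictlyAbove F p).card < F.card :=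
  Finset.card_lt_card <| Finset.ssubset_iff_subset_ne.2
    ⟨fun _ h => (mem_strictlyAbove.1 h).1, fun h =>
      (mem_strictlyAbove.1 (h ▸ hp)).2.2 (self_mem_rightIdeal p)⟩

theorem IsJoinClosed.strictlyAbove {F : Finset P} (hF : IsJoinClosed F) (p : P) :
    IsJoinClosed (strictlyAbove F p) := by
  intro r hr s hs
  rw [mem_strictlyAbove] at hr hs
  refine (hF r hr.1 s hs.1).imp_right ?_
  rintro ⟨t, ht, e⟩
  have htr : t ∈ rightIdeal r := (e.ge (self_mem_rightIdeal t)).1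
  exact ⟨t, mem_strictlyAbove.2 ⟨ht, rightIdeal_subset_iff.2 hr.2.1 htr,
    fun h => hr.2.2 (rightIdeal_subset_iff.2 htr h)⟩, e⟩

theorem exists_iInter_rightIdeal [RightLCMSemigroup P] (S : Finset P) (hS : S.Nonempty) :
    ⋂ p ∈ S, rightIdeal p = ∅ ∨ ∃ r, ⋂ p ∈ S, rightIdeal p = rightIdeal r := by
  classical
  induction hS using Finset.Nonempty.cons_induction with
  | singleton p => exact .inr ⟨p, by simp⟩
  | cons p S hp _ ih =>
    simp only [Finset.mem_cons, Set.iInter_iInter_eq_or_left]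
    rcases ih with h | ⟨r, h⟩
    · exact .inl (by rw [h, Set.inter_empty])
    · rw [h]
      exact RightLCMSemigroup.inter_rightIdeal p r

/-- A generator is chosen for each nonempty intersection of the ideals `pP`, `p ∈ F`; for
the intersection over a singleton `{p}` it has to be `p` itself. -/
theorem exists_isJoinClosed [RightLCMSemigroup P] (F : Finset P) :
    ∃ G : Finset P, F ⊆ G ∧ IsJoinClosed G := by
  classical
  have hg : ∀ S : Finset P, ∃ r : P, (∀ p, S = {p} → r = p) ∧ (S.Nonempty →
      (⋂ p ∈ S, rightIdeal p).Nonempty → ⋂ p ∈ S, rightIdeal p = rightIdeal r) := by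
    intro S
    by_cases h1 : ∃ p, S = {p}
    · obtain ⟨p, rfl⟩ := h1
      exact ⟨p, fun q h => Finset.singleton_injective h, fun _ _ => by simp⟩
    · by_cases hS : S.Nonempty
      · rcases exists_iInter_rightIdeal S hS with h | ⟨r, h⟩
        · exact ⟨1, fun p hp => (h1 ⟨p, hp⟩).elim, fun _ h' => (h'.ne_empty h).elim⟩
        · exact ⟨r, fun p hp => (h1 ⟨p, hp⟩).elim, fun _ _ => h⟩
      · exact ⟨1, fun p hp => (h1 ⟨p, hp⟩).elim, fun h => (hS h).elim⟩
  choose g hg1 hg2 using hg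
  let I := F.powerset.filter fun S => S.Nonempty ∧ (⋂ p ∈ S, rightIdeal p).Nonempty
  refine ⟨I.image g, fun p hp => ?_, ?_⟩
  · refine Finset.mem_image.2 ⟨{p}, ?_, hg1 _ p rfl⟩
    simpa [I, hp] using ⟨p, self_mem_rightIdeal p⟩
  · intro p hp q hq
    obtain ⟨S, hS, rfl⟩ := Finset.mem_image.1 hp
    obtain ⟨T, hT, rfl⟩ := Finset.mem_image.1 hq
    simp only [I, Finset.mem_filter, Finset.mem_powerset] at hS hT
    rw [← hg2 S hS.2.1 hS.2.2, ← hg2 T hT.2.1 hT.2.2]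
    have e : (⋂ p ∈ S, rightIdeal p) ∩ ⋂ p ∈ T, rightIdeal p = ⋂ p ∈ S ∪ T, rightIdeal p := by
      simp only [Finset.mem_union, Set.iInter_or, Set.iInter_inter_distrib]
    rw [e]
    refine (Set.eq_empty_or_nonempty _).imp_right fun hn => ?_
    have hne : (S ∪ T).Nonempty := hS.2.1.mono Finset.subset_union_left
    refine ⟨g (S ∪ T), Finset.mem_image_of_mem g ?_, hg2 _ hne hn⟩
    simp only [I, Finset.mem_filter, Finset.mem_powerset]
    exact ⟨Finset.union_subset hS.1 hT.1, hne, hn⟩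

end RightIdeals

/-! ### Local cores of Nica covariant representations -/

/-- The restriction of a representation to the `C^*`-algebra of endomorphisms of an object. -/
def CStarPrecategory.Representation.diagHom {O : Type u} {C : CStarPrecategory.{u, v} O}
    {B : Type w} [NonUnitalCStarAlgebra B] (Φ : C.Representation B) (ρ : O) :
    C.Hom ρ ρ →⋆ₙₐ[ℂ] B where
  toFun := Φ.toFun ρ ρ
  map_smul' c x := map_smul _ c x
  map_zero' := map_zero _
  map_add' := map_add _
  map_mul' x y := Φ.map_comp x y
  map_star' x := Φ.map_adj x

namespace RightTensorPrecategory

open CStarPrecategory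

section LocalCore

variable {P : Type u} [Monoid P] {L : RightTensorPrecategory.{u, v} P}
  {K : L.Ideal} {hK : L.IsWellAligned K} {B : Type w} [NonUnitalCStarAlgebra B]
  {Φ : K.toPrecategory.Representation B}

theorem IsNicaCovariant.mul_mem_range (hΦ : IsNicaCovariant hK Φ) {p q r : P}
    (hr : rightIdeal p ∩ rightIdeal q = rightIdeal r)
    (a : K.toPrecategory.Hom p p) (b : K.toPrecategory.Hom q q) :
    Φ.toFun p p a * Φ.toFun q q b ∈ Set.range (Φ.toFun r r) := by
  obtain ⟨⟨v, hv⟩, ⟨w, hw⟩⟩ := hr.ge (self_mem_rightIdeal r)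
  rw [(hΦ p p q q a b).1 r v w hv hw hr]
  have key : ∀ (x y : P) (_ : x = r) (_ : y = r) (c : K.toPrecategory.Hom x y),
      Φ.toFun x y c ∈ Set.range (Φ.toFun r r) := by
    rintro _ _ rfl rfl c
    exact ⟨c, rfl⟩
  exact key _ _ hv hw _

theorem IsNicaCovariant.mul_eq_zero (hΦ : IsNicaCovariant hK Φ) {p q : P}
    (hr : rightIdeal p ∩ rightIdeal q = ∅)
    (a : K.toPrecategory.Hom p p) (b : K.toPrecategory.Hom q q) :
    Φ.toFun p p a * Φ.toFun q q b = 0 :=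
  (hΦ p p q q a b).2 fun r h => Set.notMem_empty r (hr ▸ h.ge (self_mem_rightIdeal r))

/-- The closed linear span of the spaces `Φ(K(q,q))`, `q ∈ F`, for a join-closed finite set `F`,
as a `C^*`-algebra. -/
def IsNicaCovariant.localCore (hΦ : IsNicaCovariant hK Φ) {F : Finset P} (hF : IsJoinClosed F) :
    NonUnitalStarSubalgebra ℂ B :=
  (NonUnitalStarSubalgebra.ofSpan (⋃ q ∈ F, Set.range (Φ.toFun q q))
    (by
      intro a ha b hb
      obtain ⟨p, hp, a, rfl⟩ := Set.mem_iUnion₂.1 ha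
      obtain ⟨q, hq, b, rfl⟩ := Set.mem_iUnion₂.1 hb
      rcases hF p hp q hq with h | ⟨r, hr, h⟩
      · rw [hΦ.mul_eq_zero h]
        exact zero_mem _
      · exact Submodule.subset_span (Set.mem_iUnion₂.2 ⟨r, hr, hΦ.mul_mem_range h a b⟩))
    (by
      intro a ha
      obtain ⟨p, hp, a, rfl⟩ := Set.mem_iUnion₂.1 ha
      exact Set.mem_iUnion₂.2
        ⟨p, hp, K.toPrecategory.adj a, Φ.map_adj a⟩)).topologicalClosure

theorem IsNicaCovariant.isClosed_localCore (hΦ : IsNicaCovariant hK Φ) {F : Finset P}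
    (hF : IsJoinClosed F) : IsClosed (hΦ.localCore hF : Set B) :=
  NonUnitalStarSubalgebra.isClosed_topologicalClosure _

theorem IsNicaCovariant.apply_mem_localCore (hΦ : IsNicaCovariant hK Φ) {F : Finset P}
    (hF : IsJoinClosed F) {q : P} (hq : q ∈ F) (b : K.toPrecategory.Hom q q) :
    Φ.toFun q q b ∈ hΦ.localCore hF :=
  subset_closure (Submodule.subset_span (Set.mem_iUnion₂.2 ⟨q, hq, b, rfl⟩))

theorem IsNicaCovariant.map_localCore (hΦ : IsNicaCovariant hK Φ) {F : Finset P}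
    (hF : IsJoinClosed F) {E : Type*} [NormedAddCommGroup E] [NormedSpace ℂ E] (f : B →L[ℂ] E)
    (V : Submodule ℂ E)
    (h : ∀ q ∈ F, ∀ b, f (Φ.toFun q q b) ∈ V) {x : B} (hx : x ∈ hΦ.localCore hF) :
    f x ∈ V.topologicalClosure := by
  refine map_mem_closure f.continuous hx fun y hy => ?_
  have hs : Submodule.span ℂ (⋃ q ∈ F, Set.range (Φ.toFun q q)) ≤ V.comap f.toLinearMap := by
    refine Submodule.span_le.2 (Set.iUnion₂_subset fun q hq => ?_)
    rintro _ ⟨b, rfl⟩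
    exact h q hq b
  exact hs hy

theorem IsNicaCovariant.mul_mem_localCore_strictlyAbove (hΦ : IsNicaCovariant hK Φ) {F : Finset P}
    (hF : IsJoinClosed F) (p : P) (a : K.toPrecategory.Hom p p) {c : B}
    (hc : c ∈ hΦ.localCore (hF.strictlyAbove p)) :
    Φ.toFun p p a * c ∈ hΦ.localCore (hF.strictlyAbove p) := by
  have h := hΦ.map_localCore (hF.strictlyAbove p) (ContinuousLinearMap.mul ℂ B (Φ.toFun p p a))
    (hΦ.localCore (hF.strictlyAbove p)).toSubmodule (fun q hq b => ?_) hc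
  · rwa [IsClosed.submodule_topologicalClosure_eq (hΦ.isClosed_localCore (hF.strictlyAbove p))] at h
  · have hq' := (mem_strictlyAbove.1 hq).2.1
    obtain ⟨c, hc⟩ := hΦ.mul_mem_range
      (Set.inter_eq_right.2 (rightIdeal_subset_iff.2 hq')) a b
    change Φ.toFun p p a * Φ.toFun q q b ∈ hΦ.localCore (hF.strictlyAbove p)
    rw [← hc]
    exact hΦ.apply_mem_localCore _ hq c

/-- Multiplication by `Φ(K(p,p))` moves the local core of `F` into the closure of
`Φ(K(p,p)) + ∑ Φ(K(r,r))`, the sum over the `r ∈ F` strictly above `p`. -/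
theorem IsNicaCovariant.exists_norm_mul_sub_lt (hΦ : IsNicaCovariant hK Φ) {F : Finset P}
    (hF : IsJoinClosed F) {p : P} (hp : p ∈ F) (a : K.toPrecategory.Hom p p) {x : B}
    (hx : x ∈ hΦ.localCore hF) {ε : ℝ} (hε : 0 < ε) :
    ∃ d : K.toPrecategory.Hom p p, ∃ c ∈ hΦ.localCore (hF.strictlyAbove p),
      ‖Φ.toFun p p a * x - (Φ.toFun p p d + c)‖ < ε := by
  have h := hΦ.map_localCore hF (ContinuousLinearMap.mul ℂ B (Φ.toFun p p a))
    (LinearMap.range (Φ.toFun p p) ⊔ (hΦ.localCore (hF.strictlyAbove p)).toSubmodule)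
    (fun q hq b => ?_) hx
  · obtain ⟨y, hy, hxy⟩ := Metric.mem_closure_iff.1 h ε hε
    obtain ⟨_, ⟨d, rfl⟩, c, hc, rfl⟩ := Submodule.mem_sup.1 hy
    exact ⟨d, c, hc, by rwa [dist_eq_norm] at hxy⟩
  · change Φ.toFun p p a * Φ.toFun q q b ∈ _
    rcases hF p hp q hq with h | ⟨r, hr, h⟩
    · rw [hΦ.mul_eq_zero h]
      exact zero_mem _
    · have hrp : r ∈ rightIdeal p := (h.ge (self_mem_rightIdeal r)).1
      by_cases hpr : p ∈ rightIdeal r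
      -- here `rP = pP`, so that `p` itself may serve as the generator of `pP ∩ qP`
      · refine Submodule.mem_sup_left (hΦ.mul_mem_range (h.trans ?_) a b)
        exact (rightIdeal_subset_iff.2 hrp).antisymm (rightIdeal_subset_iff.2 hpr)
      · obtain ⟨c, hc⟩ := hΦ.mul_mem_range h a b
        rw [← hc]
        exact Submodule.mem_sup_right
          (hΦ.apply_mem_localCore (hF.strictlyAbove p) (mem_strictlyAbove.2 ⟨hr, hrp, hpr⟩) c)

/-- Toeplitz covariance in quantitative form: the distance of `Φ(d)`, `d ∈ K(p,p)`, to the part of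
the core strictly above `p` is `‖d‖`. -/
theorem IsNicaCovariant.norm_le_norm_apply_add (hΦ : IsNicaCovariant hK Φ) (hi : Φ.IsInjective)
    (ht : IsToeplitzCovariant Φ) {F : Finset P} (hF : IsJoinClosed F) (p : P)
    (d : K.toPrecategory.Hom p p) {c : B} (hc : c ∈ hΦ.localCore (hF.strictlyAbove p)) :
    ‖d‖ ≤ ‖Φ.toFun p p d + c‖ := by
  refine NonUnitalStarAlgHom.norm_le_norm_add (Φ.diagHom p) (hΦ.localCore (hF.strictlyAbove p))
    (hΦ.isClosed_localCore _) (fun a c hc => hΦ.mul_mem_localCore_strictlyAbove hF p a hc)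
    (fun a ha => hi p ?_) d hc
  rw [map_zero]
  have h := ht p (strictlyAbove F p) fun q hq => (mem_strictlyAbove.1 hq).2.2
  exact h.le ⟨⟨a, rfl⟩, ha⟩

theorem isToeplitzCovariant_of_forall
    (h : ∀ (p : P) (F : Finset P), (∀ q ∈ F, p ∉ rightIdeal q) → ∀ a,
      Φ.toFun p p a ∈ closure (Submodule.span ℂ (⋃ q ∈ F, Set.range (Φ.toFun q q)) : Set B) →
      Φ.toFun p p a = 0) : IsToeplitzCovariant Φ := by
  intro p F hF
  refine Set.Subset.antisymm ?_
    (Set.singleton_subset_iff.2 ⟨zero_mem _, subset_closure (zero_mem _)⟩)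
  rintro _ ⟨⟨a, rfl⟩, ha⟩
  exact h p F hF a ha

variable {B' : Type*} [NonUnitalCStarAlgebra B'] {Ψ : K.toPrecategory.Representation B'}

theorem IsNicaCovariant.map_mem_localCore (hΦ : IsNicaCovariant hK Φ) (hΨ : IsNicaCovariant hK Ψ)
    (π : B' →⋆ₙₐ[ℂ] B) (hπ : ∀ p a, π (Ψ.toFun p p a) = Φ.toFun p p a) {F : Finset P}
    (hF : IsJoinClosed F) {x : B'} (hx : x ∈ hΨ.localCore hF) : π x ∈ hΦ.localCore hF := by
  let f : B' →L[ℂ] B :=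
    ⟨{ toFun := π, map_add' := map_add π, map_smul' := map_smul π }, π.continuous_of_cstar⟩
  have h := hΨ.map_localCore hF f (hΦ.localCore hF).toSubmodule (fun q hq b => ?_) hx
  · rwa [IsClosed.submodule_topologicalClosure_eq (hΦ.isClosed_localCore hF)] at h
  · change π (Ψ.toFun q q b) ∈ hΦ.localCore hF
    rw [hπ]
    exact hΦ.apply_mem_localCore hF hq b

/-- Injectivity on the local cores, by induction on the number of elements of `F`. If `π x = 0`
then for `a ∈ K(p,p)` the element `Ψ(a) x` has no component in `Ψ(K(p,p))`, so that it lies in the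
local core strictly above `p` and vanishes by induction. Hence `x^* x = 0`. -/
theorem IsNicaCovariant.eq_zero_of_mem_localCore (hΦ : IsNicaCovariant hK Φ) (hi : Φ.IsInjective)
    (ht : IsToeplitzCovariant Φ) (hΨ : IsNicaCovariant hK Ψ)
    (π : B' →⋆ₙₐ[ℂ] B) (hπ : ∀ p a, π (Ψ.toFun p p a) = Φ.toFun p p a) (n : ℕ) :
    ∀ {F : Finset P} (hF : IsJoinClosed F), F.card = n → ∀ x ∈ hΨ.localCore hF, π x = 0 →
      x = 0 := by
  induction n using Nat.strong_induction_on with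
  | _ n ih =>
  intro F hF hn x hx hx0
  have key : ∀ p ∈ F, ∀ a, Ψ.toFun p p a * x = 0 := by
    intro p hp a
    have hz : π (Ψ.toFun p p a * x) = 0 := by rw [map_mul, hx0, mul_zero]
    refine ih _ (hn ▸ card_strictlyAbove_lt hp) (hF.strictlyAbove p) rfl _ ?_ hz
    refine (hΨ.isClosed_localCore (hF.strictlyAbove p)).closure_subset
      (Metric.mem_closure_iff.2 fun ε hε => ?_)
    obtain ⟨d, c, hc, hdc⟩ := hΨ.exists_norm_mul_sub_lt hF hp a hx (half_pos hε)
    refine ⟨c, hc, ?_⟩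
    have h1 := hΦ.norm_le_norm_apply_add hi ht hF p d (hΦ.map_mem_localCore hΨ π hπ _ hc)
    have h2 := NonUnitalStarAlgHom.norm_apply_le π (Ψ.toFun p p a * x - (Ψ.toFun p p d + c))
    rw [map_sub, hz, zero_sub, norm_neg, map_add, hπ] at h2
    have h3 := Ψ.norm_map_le d
    rw [dist_eq_norm]
    calc ‖Ψ.toFun p p a * x - c‖
        = ‖Ψ.toFun p p a * x - (Ψ.toFun p p d + c) + Ψ.toFun p p d‖ := by congr 1; abel
      _ ≤ _ := norm_add_le _ _
      _ < ε := by linarith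
  have h := hΨ.map_localCore hF ((ContinuousLinearMap.mul ℂ B').flip x) ⊥
    (fun p hp a => key p hp a) (star_mem hx)
  rw [IsClosed.submodule_topologicalClosure_eq isClosed_singleton] at h
  exact CStarRing.star_mul_self_eq_zero_iff x |>.1 h

variable [RightLCMSemigroup P]

theorem IsNicaCovariant.norm_map_of_mem_core (hΦ : IsNicaCovariant hK Φ) (hi : Φ.IsInjective)
    (ht : IsToeplitzCovariant Φ) (hΨ : IsNicaCovariant hK Ψ)
    (π : B' →⋆ₙₐ[ℂ] B) (hπ : ∀ p a, π (Ψ.toFun p p a) = Φ.toFun p p a) {x : B'}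
    (hx : x ∈ hΨ.core) : ‖π x‖ = ‖x‖ := by
  refine closure_minimal (t := {x | ‖π x‖ = ‖x‖}) (fun y hy => ?_)
    (isClosed_eq π.continuous_of_cstar.norm continuous_norm) hx
  have hy' : ∃ F : Finset P, y ∈ Submodule.span ℂ (⋃ q ∈ F, Set.range (Ψ.toFun q q)) := by
    classical
    change y ∈ Submodule.span ℂ (⋃ q : P, Set.range (Ψ.toFun q q)) at hy
    have mono : ∀ F G : Finset P, F ⊆ G → Submodule.span ℂ (⋃ q ∈ F, Set.range (Ψ.toFun q q)) ≤
        Submodule.span ℂ (⋃ q ∈ G, Set.range (Ψ.toFun q q)) := fun F G h =>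
      Submodule.span_mono (Set.biUnion_subset_biUnion_left h)
    induction hy using Submodule.span_induction with
    | mem y hy =>
      obtain ⟨q, hq⟩ := Set.mem_iUnion.1 hy
      exact ⟨{q}, Submodule.subset_span (by simpa using hq)⟩
    | zero => exact ⟨∅, zero_mem _⟩
    | add y z _ _ hy hz =>
      obtain ⟨F, hF⟩ := hy
      obtain ⟨G, hG⟩ := hz
      exact ⟨F ∪ G, add_mem (mono _ _ Finset.subset_union_left hF)
        (mono _ _ Finset.subset_union_right hG)⟩
    | smul c y _ hy =>
      obtain ⟨F, hF⟩ := hy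
      exact ⟨F, Submodule.smul_mem _ c hF⟩
  obtain ⟨F, hF⟩ := hy'
  obtain ⟨G, hFG, hG⟩ := exists_isJoinClosed F
  refine NonUnitalStarAlgHom.norm_map_of_mem π (hΨ.localCore hG) (hΨ.isClosed_localCore hG)
    (hΦ.eq_zero_of_mem_localCore hi ht hΨ π hπ _ hG rfl) ?_
  exact subset_closure (Submodule.span_mono (Set.biUnion_subset_biUnion_left hFG) hF)

end LocalCore

/-! ### Homomorphisms injective on the core -/

section Transfer

variable {P : Type u} [Monoid P] {L : RightTensorPrecategory.{u, v} P}
  {K : L.Ideal} {hK : L.IsWellAligned K} {B : Type w} [NonUnitalCStarAlgebra B]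
  {Φ : K.toPrecategory.Representation B}
  {B' : Type*} [NonUnitalCStarAlgebra B'] {Ψ : K.toPrecategory.Representation B'}

theorem IsNicaCovariant.isInjective_of_injOn (hΨ : IsNicaCovariant hK Ψ) (hi : Ψ.IsInjective)
    (π : B' →⋆ₙₐ[ℂ] B) (hπ : ∀ p a, π (Ψ.toFun p p a) = Φ.toFun p p a)
    (hinj : Set.InjOn π (hΨ.core : Set B')) : Φ.IsInjective := by
  have hm : ∀ p a, Ψ.toFun p p a ∈ hΨ.core := fun p a =>
    subset_closure (Submodule.subset_span (Set.mem_iUnion.2 ⟨p, a, rfl⟩))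
  intro p a b hab
  refine hi p (hinj (hm p a) (hm p b) ?_)
  rw [hπ, hπ, hab]

/-- A homomorphism that is injective on the core of `Ψ` is isometric there, so it maps the closed
span of the `Ψ(K(q,q))`, `q ∈ F`, onto that of the `Φ(K(q,q))`. -/
theorem IsNicaCovariant.isToeplitzCovariant_of_injOn (hΨ : IsNicaCovariant hK Ψ)
    (ht : IsToeplitzCovariant Ψ) (π : B' →⋆ₙₐ[ℂ] B)
    (hπ : ∀ p a, π (Ψ.toFun p p a) = Φ.toFun p p a)
    (hinj : Set.InjOn π (hΨ.core : Set B')) : IsToeplitzCovariant Φ := by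
  have hcl : IsClosed (hΨ.core : Set B') := NonUnitalStarSubalgebra.isClosed_topologicalClosure _
  have hn : ∀ x ∈ hΨ.core, ‖π x‖ = ‖x‖ := fun x hx =>
    NonUnitalStarAlgHom.norm_map_of_mem π hΨ.core hcl
      (fun x hx h => hinj hx (zero_mem hΨ.core) (h.trans (map_zero π).symm)) hx
  have hm : ∀ p a, Ψ.toFun p p a ∈ hΨ.core := fun p a =>
    subset_closure (Submodule.subset_span (Set.mem_iUnion.2 ⟨p, a, rfl⟩))
  refine isToeplitzCovariant_of_forall fun p F hF a ha => ?_
  let V := Submodule.span ℂ (⋃ q ∈ F, Set.range (Ψ.toFun q q))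
  have hV : (V : Set B') ⊆ hΨ.core := fun y hy => subset_closure
    (Submodule.span_mono (Set.iUnion₂_subset fun q _ =>
      Set.subset_iUnion (fun q => Set.range (Ψ.toFun q q)) q) hy)
  have hlift : ∀ x ∈ Submodule.span ℂ (⋃ q ∈ F, Set.range (Φ.toFun q q)), ∃ y ∈ V, π y = x := by
    intro x hx
    induction hx using Submodule.span_induction with
    | mem x hx =>
      obtain ⟨q, hq, b, rfl⟩ := Set.mem_iUnion₂.1 hx
      exact ⟨_, Submodule.subset_span (Set.mem_iUnion₂.2 ⟨q, hq, b, rfl⟩), hπ q b⟩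
    | zero => exact ⟨0, zero_mem _, map_zero π⟩
    | add x x' _ _ hx hx' =>
      obtain ⟨y, hy, rfl⟩ := hx
      obtain ⟨y', hy', rfl⟩ := hx'
      exact ⟨y + y', add_mem hy hy', map_add π y y'⟩
    | smul c x _ hx =>
      obtain ⟨y, hy, rfl⟩ := hx
      exact ⟨c • y, Submodule.smul_mem _ c hy, map_smul π c y⟩
  have h0 : Ψ.toFun p p a = 0 := by
    refine (ht p F hF).le ⟨⟨a, rfl⟩, Metric.mem_closure_iff.2 fun ε hε => ?_⟩
    obtain ⟨x, hx, hax⟩ := Metric.mem_closure_iff.1 ha ε hε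
    obtain ⟨y, hy, rfl⟩ := hlift x hx
    refine ⟨y, hy, ?_⟩
    rw [dist_eq_norm, ← hn _ (sub_mem (hm p a) (hV hy)), map_sub, hπ, ← dist_eq_norm]
    exact hax
  rw [← hπ, h0, map_zero]

/-- A homomorphism that is injective on the core is isometric there, so the image of the core is
closed; it contains the spaces `Φ(K(p,p))`. -/
theorem IsNicaCovariant.bijective_integratedCore_iff (hΦ : IsNicaCovariant hK Φ) :
    Function.Bijective hΦ.integratedCore ↔
      Set.InjOn hΦ.integrated ((isNicaCovariant_universalRep hK).core : Set (NT hK)) := by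
  constructor
  · intro h x hx y hy hxy
    exact congrArg Subtype.val
      (h.1 (a₁ := ⟨x, hx⟩) (a₂ := ⟨y, hy⟩) (Subtype.ext hxy))
  · intro h
    refine ⟨fun x y hxy => Subtype.ext (h x.2 y.2 (congrArg Subtype.val hxy)), ?_⟩
    have hcl : IsClosed ((isNicaCovariant_universalRep hK).core : Set (NT hK)) :=
      NonUnitalStarSubalgebra.isClosed_topologicalClosure _
    let _ : NonUnitalCStarAlgebra (isNicaCovariant_universalRep hK).core :=
      NonUnitalStarSubalgebra.nonUnitalCStarAlgebra _ (h_closed := hcl)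
    let ρ : (isNicaCovariant_universalRep hK).core →⋆ₙₐ[ℂ] B := hΦ.integrated.comp
      (NonUnitalStarSubalgebraClass.subtype (isNicaCovariant_universalRep hK).core)
    have hρ : Isometry ρ := NonUnitalStarAlgHom.isometry ρ
      fun x y hxy => Subtype.ext (h x.2 y.2 hxy)
    have hR : IsClosed (Set.range ρ) := hρ.isClosedEmbedding.isClosed_range
    have hsub : (hΦ.core : Set B) ⊆ Set.range ρ := by
      refine closure_minimal (fun y hy => ?_) hR
      change y ∈ Submodule.span ℂ (⋃ p : P, Set.range (Φ.toFun p p)) at hy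
      induction hy using Submodule.span_induction with
      | mem y hy =>
        obtain ⟨p, a, rfl⟩ := Set.mem_iUnion.1 hy
        exact ⟨⟨(universalRep hK).toFun p p a,
          subset_closure (Submodule.subset_span (Set.mem_iUnion.2 ⟨p, a, rfl⟩))⟩,
          hΦ.integrated_apply a⟩
      | zero => exact ⟨0, map_zero ρ⟩
      | add y z _ _ hy hz =>
        obtain ⟨y, rfl⟩ := hy
        obtain ⟨z, rfl⟩ := hz
        exact ⟨y + z, map_add ρ y z⟩
      | smul c y _ hy =>
        obtain ⟨y, rfl⟩ := hy
        exact ⟨c • y, map_smul ρ c y⟩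
    intro y
    obtain ⟨x, hx⟩ := hsub y.2
    exact ⟨x, Subtype.ext hx⟩

end Transfer

/-! ### The Fock representation -/

section FockModule

variable {P : Type u} [Monoid P] {L : RightTensorPrecategory.{u, v} P} (K : L.Ideal)

open Classical in
/-- The vector of the Fock module of `K` concentrated in the summand `K(s,t)`. -/
noncomputable def fockSingle {s t : P} (x : K.toPrecategory.Hom s t) :
    K.toPrecategory.FockModule :=
  ⟨Pi.single (M := fun i : P × P => K.toPrecategory.Hom i.1 i.2) (s, t) x, by
    refine summable_of_ne_finset_zero (s := {(s, t)}) fun i hi => ?_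
    rw [Pi.single_eq_of_ne (by simpa using hi), CStarModule.inner_zero_right]⟩

theorem fockSingle_apply {s t : P} (x : K.toPrecategory.Hom s t) :
    (fockSingle K x).1 (s, t) = x := by
  classical
  exact Pi.single_eq_same (M := fun i : P × P => K.toPrecategory.Hom i.1 i.2) (s, t) x

end FockModule

section Fock

variable {P : Type u} [Monoid P] [IsLeftCancelMul P] {L : RightTensorPrecategory.{u, v} P}
  (K : L.Ideal)

theorem fockFun_self {p q : P} (a : L.Hom p q)
    (x : ∀ i : P × P, K.toPrecategory.Hom i.1 i.2) (t : P) :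
    fockFun K a x (p, t) = K.lmul a (x (q, t)) := by
  refine Subtype.ext (eq_of_heq ?_)
  have h1 : HEq (fockFun K a x (p, t)).1 (fockFun K a x (p * 1, t)).1 :=
    coe_heq (fockFun K a x) (by rw [mul_one])
  rw [fockFun_mul] at h1
  exact h1.trans (comp_heq (mul_one p) (mul_one q) rfl (L.tens_one a)
    (coe_heq x (by rw [mul_one])))

/-- The component of `T(a) a^*` at `(p,p)` is `a a^*`. -/
theorem eq_zero_of_fock_fockSingle {p : P} (a : K.toPrecategory.Hom p p)
    (h : (((fock K).toFun p p a).1 (fockSingle K (K.toPrecategory.adj a))).1 (p, p) = 0) :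
    a = 0 := by
  have h1 : K.toPrecategory.comp a (K.toPrecategory.adj a) = 0 := by
    rw [← fockSingle_apply K (K.toPrecategory.adj a), ← h]
    exact (fockFun_self K a.1 _ p).symm
  have h2 := K.toPrecategory.norm_adj_comp_self (K.toPrecategory.adj a)
  rw [K.toPrecategory.adj_adj, h1, norm_zero, K.toPrecategory.norm_adj] at h2
  exact norm_eq_zero.1 (pow_eq_zero_iff two_ne_zero |>.1 h2.symm)

theorem isInjective_fock : (fock K).IsInjective := fun p =>
  (injective_iff_map_eq_zero _).2 fun a ha => eq_zero_of_fock_fockSingle K a (by rw [ha]; rfl)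

/-- For `p ∉ qP` the operators in `T(K(q,q))` have no components in `K(p,p)`. -/
theorem isToeplitzCovariant_fock : IsToeplitzCovariant (fock K) := by
  refine isToeplitzCovariant_of_forall fun p F hF a ha => ?_
  have key : ∀ x : K.toPrecategory.FockModule, ∀ S ∈ closure (Submodule.span ℂ
      (⋃ q ∈ F, Set.range ((fock K).toFun q q)) : Set K.toPrecategory.FockAlgebra),
      (S.1 x).1 (p, p) = 0 := by
    intro x S hS
    let f : K.toPrecategory.FockAlgebra →ₗ[ℂ] K.toPrecategory.Hom p p :=
      { toFun := fun S => (S.1 x).1 (p, p)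
        map_add' := fun _ _ => rfl
        map_smul' := fun _ _ => rfl }
    have hf : Continuous f := AddMonoidHomClass.continuous_of_bound f ‖x‖ fun S => by
      rw [mul_comm]
      exact (CStarModule.DirectSum.norm_apply_le (S.1 x) (p, p)).trans (S.1.le_opNorm x)
    refine closure_minimal (fun S hS => ?_) (isClosed_singleton.preimage hf) hS
    refine (Submodule.span_le (p := LinearMap.ker f)).2 (Set.iUnion₂_subset fun q hq => ?_) hS
    rintro _ ⟨b, rfl⟩
    exact fockFun_of_notMem K b.1 x.1 (i := (p, p)) (hF q hq)
  rw [eq_zero_of_fock_fockSingle K a (key _ _ ha), map_zero]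

end Fock

/-! ### The universal representation -/

section Universal

variable {P : Type u} [Monoid P] [RightLCMSemigroup P] {L : RightTensorPrecategory.{u, v} P}
  {K : L.Ideal} {hK : L.IsWellAligned K}

theorem isInjective_universalRep : (universalRep hK).IsInjective := by
  intro p a b hab
  refine isInjective_fock K p ?_
  rw [← (isNicaCovariant_fock hK).integrated_apply, hab,
    (isNicaCovariant_fock hK).integrated_apply]

variable {B : Type w} [NonUnitalCStarAlgebra B] {Φ : K.toPrecategory.Representation B}

theorem IsNicaCovariant.injOn_integrated (hΦ : IsNicaCovariant hK Φ) (hi : Φ.IsInjective)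
    (ht : IsToeplitzCovariant Φ) :
    Set.InjOn hΦ.integrated ((isNicaCovariant_universalRep hK).core : Set (NT hK)) := by
  intro x hx y hy h
  have hn := hΦ.norm_map_of_mem_core hi ht (isNicaCovariant_universalRep hK) hΦ.integrated
    (fun p a => hΦ.integrated_apply a) (sub_mem hx hy)
  rw [map_sub, h, sub_self, norm_zero] at hn
  exact sub_eq_zero.1 (norm_eq_zero.1 hn.symm)

/-- The universal representation inherits Toeplitz covariance from the Fock representation `T`, since
`T ⋊ P` maps closed spans into closed spans and `T` is injective. -/
theorem isToeplitzCovariant_universalRep : IsToeplitzCovariant (universalRep hK) := by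
  have hT := isNicaCovariant_fock hK
  refine isToeplitzCovariant_of_forall fun p F hF a ha => ?_
  have h1 : (fock K).toFun p p a ∈ closure
      (Submodule.span ℂ (⋃ q ∈ F, Set.range ((fock K).toFun q q)) : Set _) := by
    rw [← hT.integrated_apply]
    refine map_mem_closure hT.integrated.continuous_of_cstar ha fun y hy => ?_
    change y ∈ Submodule.span ℂ (⋃ q ∈ F, Set.range ((universalRep hK).toFun q q)) at hy
    change _ ∈ Submodule.span ℂ _
    induction hy using Submodule.span_induction with
    | mem y hy =>
      obtain ⟨q, hq, b, rfl⟩ := Set.mem_iUnion₂.1 hy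
      rw [hT.integrated_apply]
      exact Submodule.subset_span (Set.mem_iUnion₂.2 ⟨q, hq, b, rfl⟩)
    | zero => rw [map_zero]; exact zero_mem _
    | add y z _ _ hy hz => rw [map_add]; exact add_mem hy hz
    | smul c y _ hy => rw [map_smul]; exact Submodule.smul_mem _ _ hy
  have h2 : (fock K).toFun p p a = 0 := (isToeplitzCovariant_fock K p F hF).le ⟨⟨a, rfl⟩, h1⟩
  have h3 : a = 0 := isInjective_fock K p (h2.trans (map_zero _).symm)
  rw [h3, map_zero]

theorem IsNicaCovariant.injOn_integrated_iff (hΦ : IsNicaCovariant hK Φ) :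
    Set.InjOn hΦ.integrated ((isNicaCovariant_universalRep hK).core : Set (NT hK)) ↔
      Φ.IsInjective ∧ IsToeplitzCovariant Φ :=
  ⟨fun h =>
    ⟨(isNicaCovariant_universalRep hK).isInjective_of_injOn isInjective_universalRep
        hΦ.integrated (fun _ a => hΦ.integrated_apply a) h,
      (isNicaCovariant_universalRep hK).isToeplitzCovariant_of_injOn
        isToeplitzCovariant_universalRep hΦ.integrated (fun _ a => hΦ.integrated_apply a) h⟩,
    fun h => hΦ.injOn_integrated h.1 h.2⟩

end Universal

end RightTensorPrecategory

theorem mainTheorem4 {P : Type u} [Monoid P] [RightLCMSemigroup P]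
    (L : RightTensorPrecategory.{u, v} P) (K : L.Ideal) (hK : L.IsWellAligned K) :
    (∃ hT : RightTensorPrecategory.IsNicaCovariant hK (RightTensorPrecategory.fock K),
      (RightTensorPrecategory.fock K).IsInjective ∧
      RightTensorPrecategory.IsToeplitzCovariant (RightTensorPrecategory.fock K) ∧
      Function.Bijective hT.integratedCore) ∧
    ∀ (B : Type w) [NonUnitalCStarAlgebra B] (Φ : K.toPrecategory.Representation B)
      (hΦ : RightTensorPrecategory.IsNicaCovariant hK Φ),
      (Function.Bijective hΦ.integratedCore ↔
        Φ.IsInjective ∧ RightTensorPrecategory.IsToeplitzCovariant Φ) ∧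
      (Set.InjOn hΦ.integrated
          ((RightTensorPrecategory.isNicaCovariant_universalRep hK).core : Set _) ↔
        Φ.IsInjective ∧ RightTensorPrecategory.IsToeplitzCovariant Φ) := by
  have hT := RightTensorPrecategory.isNicaCovariant_fock hK
  have hi := RightTensorPrecategory.isInjective_fock K
  have ht := RightTensorPrecategory.isToeplitzCovariant_fock K
  refine ⟨⟨hT, hi, ht, hT.bijective_integratedCore_iff.2 (hT.injOn_integrated hi ht)⟩, ?_⟩
  intro B _ Φ hΦ
  exact ⟨hΦ.bijective_integratedCore_iff.trans hΦ.injOn_integrated_iff, hΦ.injOn_integrated_iff⟩
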